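/- Let $(\Gamma,\psi)$ be an \emph{$H$-asymptotic couple}: $\Gamma$ is a (totally) ordered abelian group and $\psi:\Gamma\setminus\{0\}\to\Gamma$ satisfies, for all $\alpha,\beta\in\Gamma\setminus\{0\}$: $\psi(\alpha+\beta)\ge\min(\psi(\alpha),\psi(\beta))$ if $\alpha+\beta\ne0$; $\psi(r\alpha)=\psi(\alpha)$ for all $r\in\mathbb Z\setminus\{0\}$; $\alpha+\psi(\alpha)>\psi(\beta)$ if $\alpha>0$; and $\psi(\alpha)\ge\psi(\beta)$ if $0<\alpha\le\beta$. Put $\Psi:=\psi(\Gamma\setminus\{0\})$. Assume that $(\Gamma,\psi)$ is a model of $T_{\log}$, that is: $\Gamma$ is divisible; every $\alpha\in\Gamma$ is of the form $\alpha=\gamma+\psi(\gamma)$ for some (necessarily unique) $\gamma=:\int\alpha\in\Gamma\setminus\{0\}$; and, with $s\alpha:=\psi(\int\alpha)$ for $\alpha\in\Gamma$, the set $\Psi$ has least element $s0>0$, each $\alpha\in\Psi$ has immediate successor $s\alpha$ in $\Psi$, and $\alpha\mapsto s\alpha$ is a bijection $\Psi\to\Psi^{>s0}:=\{x\in\Psi: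 x>s0\}$. Regard $(\Gamma,\psi)$ as a structure for the first-order language $L=\{0,+,-,<,\psi,\infty,s,p,\delta_1,\delta_2,\dots\}$ with underlying set $\Gamma_\infty=\Gamma\cup\{\infty\}$, where $\Gamma<\infty$, where $p$ is the inverse of $s:\Psi\to\Psi^{>s0}$ on $\Psi^{>s0}$ and takes the value $\infty$ elsewhere, where $\delta_n$ is division by $n$ on $\Gamma$, where $\psi(0)=\infty$, and where all functions take the value $\infty$ as soon as one of their arguments is $\infty$. Then every subset $A\subseteq\Psi$ that is definable with parameters in this structure is a finite union of points of $\Psi$ and of intervals $[\alpha,\beta)_\Psi:=\{x\in\Psi:\alpha\le x<\beta\}$ with $\alpha<\beta$ in $\Psi\cup\{\infty\}$. Consequently the ordered set $\Psi$, equipped with the structure induced from $(\Gamma,\psi)$ (whose basic relations are the sets $D\cap\Psi^n$ with $D\subseteq\Gamma_\infty^n$ definable with parameters), is o-minimal: its ordering is definable in it, and each of its subsets that is definable with parameters in the induced structure is a finite union of points and open intervals with endpoints in $\Psi\cup\{-\infty,\infty\}$. -/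

import Mathlib

open FirstOrder

noncomputable section

namespace AsymptoticCouples

/-- An asymptotic couple `(Γ, ψ)` on an ordered abelian group `Γ`.  The map `ψ` is a map
`Γ \ {0} → Γ`: the value of the total function `psi` at `0` is irrelevant, and it is used nowhere
below. -/
class AsymptoticCouple (Γ : Type*) [AddCommGroup Γ] [LinearOrder Γ] [IsOrderedAddMonoid Γ] where
  psi : Γ → Γ
  ac1 : ∀ α β : Γ, α ≠ 0 → β ≠ 0 → α + β ≠ 0 → min (psi α) (psi β) ≤ psi (α + β)
  ac2 : ∀ α : Γ, α ≠ 0 → ∀ r : ℤ, r ≠ 0 → psi (r • α) = psi α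
  ac3 : ∀ α β : Γ, α ≠ 0 → β ≠ 0 → 0 < α → psi β < α + psi α


open AsymptoticCouple (psi)

section Couple

variable (Γ : Type*) [AddCommGroup Γ] [LinearOrder Γ] [IsOrderedAddMonoid Γ] [AsymptoticCouple Γ]

/-- `Ψ = ψ(Γ \ {0})`. -/
def Psi : Set Γ := psi '' {γ : Γ | γ ≠ 0}

/-- `(Γ, ψ)` is of `H`-type. -/
def IsHType : Prop := ∀ α β : Γ, 0 < α → α ≤ β → psi β ≤ psi α

/-- `(Γ, ψ)` has asymptotic integration: every element of `Γ` is of the form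
`γ' = γ + ψ(γ)` with `γ ≠ 0`. -/
def HasAsymptoticIntegration : Prop := ∀ α : Γ, ∃ γ : Γ, γ ≠ 0 ∧ γ + psi γ = α

/-- The abelian group `Γ` is divisible. -/
def IsDivisible : Prop := ∀ n : ℕ, n ≠ 0 → ∀ α : Γ, ∃ γ : Γ, n • γ = α

variable {Γ}

/-- In a couple of `H`-type, `γ ↦ γ' = γ + ψ(γ)` is strictly increasing on `Γ \ {0}`.  Hence
integrals are unique. -/
theorem IsHType.deriv_lt (hH : IsHType Γ) {α β : Γ} (hα : α ≠ 0) (hβ : β ≠ 0) (h : α < β) :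
    α + psi α < β + psi β := by
  have hneg : ∀ γ : Γ, γ ≠ 0 → psi (-γ) = psi γ := fun γ hγ => by
    simpa using AsymptoticCouple.ac2 γ hγ (-1) (by norm_num)
  rcases lt_or_gt_of_ne hα with ha | ha
  · rcases lt_or_gt_of_ne hβ with hb | hb
    · have h1 := hH (-β) (-α) (by simpa using hb) (by simpa using h.le)
      rw [hneg α hα, hneg β hβ] at h1
      exact add_lt_add_of_lt_of_le h h1
    · calc α + psi α < psi α := by simpa using ha
        _ < β + psi β := AsymptoticCouple.ac3 β α hβ hα hb
  · have hb : 0 < β := ha.trans h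
    have hd : 0 < β - α := sub_pos.2 h
    have h1 := hH α β ha h.le
    rcases h1.lt_or_eq with h1 | h1
    · have h2 := AsymptoticCouple.ac1 (β - α) α hd.ne' hα (by simpa using hβ)
      rw [sub_add_cancel] at h2
      have h3 : psi (β - α) ≤ psi β := by
        rcases min_le_iff.1 h2 with h2 | h2
        · exact h2
        · exact absurd h2 (not_le.2 h1)
      have h4 := AsymptoticCouple.ac3 (β - α) α hd.ne' hα hd
      have h5 : psi α < (β - α) + psi β := h4.trans_le (by gcongr)
      calc α + psi α < α + ((β - α) + psi β) := by gcongr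
        _ = β + psi β := by abel
    · rw [h1]; gcongr

/-- The integral `∫ α`: the unique `γ ≠ 0` with `γ + ψ(γ) = α` (a meaningful notion for couples of
`H`-type with asymptotic integration). -/
def integral (α : Γ) : Γ := Function.invFunOn (fun γ : Γ => γ + psi γ) {γ : Γ | γ ≠ 0} α

theorem integral_spec (hI : HasAsymptoticIntegration Γ) (α : Γ) :
    integral α ≠ 0 ∧ integral α + psi (integral α) = α :=
  Function.invFunOn_pos (s := {γ : Γ | γ ≠ 0}) (f := fun γ : Γ => γ + psi γ) (hI α)

theorem integral_unique (hH : IsHType Γ) (hI : HasAsymptoticIntegration Γ) {α γ : Γ}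
    (hγ : γ ≠ 0) (h : γ + psi γ = α) : integral α = γ := by
  obtain ⟨h0, h1⟩ := integral_spec hI α
  rcases lt_trichotomy (integral α) γ with hlt | heq | hgt
  · exact absurd (h1.trans h.symm) (hH.deriv_lt h0 hγ hlt).ne
  · exact heq
  · exact absurd (h1.trans h.symm) (hH.deriv_lt hγ h0 hgt).ne'

/-- The successor function `s α = ψ(∫ α)`. -/
def succ (α : Γ) : Γ := psi (integral α)

variable (Γ)

/-- The models of the theory `T_log`: the divisible asymptotic couples of `H`-type with asymptotic
integration such that `Ψ` has least element `s 0 > 0`, each `α ∈ Ψ` has immediate successor `s α`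
in `Ψ`, and `s` restricts to a bijection from `Ψ` onto `{x ∈ Ψ | s 0 < x}`.  They are viewed as
structures for the language `Llog` below. -/
structure IsModelTlog : Prop where
  divisible : IsDivisible Γ
  hType : IsHType Γ
  asymptoticIntegration : HasAsymptoticIntegration Γ
  isLeast : IsLeast (Psi Γ) (succ 0)
  succ_zero_pos : 0 < succ (0 : Γ)
  succ_spec : ∀ α ∈ Psi Γ, succ α ∈ Psi Γ ∧ α < succ α ∧ ∀ β ∈ Psi Γ, α < β → succ α ≤ β
  succ_bij : Set.BijOn succ (Psi Γ) {x ∈ Psi Γ | succ 0 < x}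

variable {Γ}

open Classical in
/-- The function `p : Γ_∞ → Γ_∞`: on elements of `Ψ` above `s 0` it is the inverse of
`s : Ψ → {x ∈ Ψ | s 0 < x}`; elsewhere it takes the value `∞`. -/
def pred : WithTop Γ → WithTop Γ
  | ⊤ => ⊤
  | (x : Γ) =>
    if x ∈ Psi Γ ∧ succ 0 < x then ((Function.invFunOn succ (Psi Γ) x : Γ) : WithTop Γ) else ⊤

open Classical in
/-- `ψ` on `Γ_∞`, with `ψ(0) = ψ(∞) = ∞`. -/
def psiTop : WithTop Γ → WithTop Γ
  | ⊤ => ⊤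
  | (x : Γ) => if x = 0 then ⊤ else (psi x : Γ)

/-- Division by `n` in `Γ` (meaningful for `n ≥ 1` and `Γ` divisible). -/
def divNat (n : ℕ) (α : Γ) : Γ := Function.invFun (fun γ : Γ => n • γ) α

end Couple

section Language

/-- Function symbols of the language `L = {0, +, -, <, ψ, ∞, s, p, δ₁, δ₂, …}`. -/
inductive LlogFunc : ℕ → Type
  | zero : LlogFunc 0
  | infty : LlogFunc 0
  | neg : LlogFunc 1
  | psi : LlogFunc 1
  | succ : LlogFunc 1
  | pred : LlogFunc 1
  | delta (n : ℕ+) : LlogFunc 1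
  | add : LlogFunc 2

/-- The only relation symbol of `L` is the binary symbol `<`. -/
inductive LlogRel : ℕ → Type
  | lt : LlogRel 2

/-- The language `L = {0, +, -, <, ψ, ∞, s, p, δ₁, δ₂, …}`. -/
def Llog : Language := ⟨LlogFunc, LlogRel⟩

variable (Γ : Type*) [AddCommGroup Γ] [LinearOrder Γ] [IsOrderedAddMonoid Γ] [AsymptoticCouple Γ]

/-- The `L`-structure with underlying set `Γ_∞ = Γ ∪ {∞}`, with `∞` as default value. -/
instance : Llog.Structure (WithTop Γ) where
  funMap {_} f := match f with
    | LlogFunc.zero => fun _ => ((0 : Γ) : WithTop Γ)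
    | LlogFunc.infty => fun _ => ⊤
    | LlogFunc.neg => fun x => (x 0).map (fun γ : Γ => -γ)
    | LlogFunc.psi => fun x => psiTop (x 0)
    | LlogFunc.succ => fun x => (x 0).map (fun γ : Γ => AsymptoticCouples.succ γ)
    | LlogFunc.pred => fun x => AsymptoticCouples.pred (x 0)
    | LlogFunc.delta n => fun x => (x 0).map (fun γ : Γ => divNat (n : ℕ) γ)
    | LlogFunc.add => fun x => x 0 + x 1
  RelMap {_} r := match r with
    | LlogRel.lt => fun x => x 0 < x 1

/-- `Ψ`, regarded as a subset of the underlying set `Γ_∞` of the structure. -/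
def PsiTop : Set (WithTop Γ) := (fun γ : Γ => (γ : WithTop Γ)) '' Psi Γ

/-- An interval in `Ψ`: a set `[α, β)_Ψ = {x ∈ Ψ | α ≤ x < β}` with `α < β` in
`Ψ_∞ = Ψ ∪ {∞}`. -/
def IsPsiInterval (I : Set (WithTop Γ)) : Prop :=
  ∃ α ∈ PsiTop Γ ∪ {⊤}, ∃ β ∈ PsiTop Γ ∪ {⊤}, α < β ∧ I = {x ∈ PsiTop Γ | α ≤ x ∧ x < β}

end Language

section Induced

/-- The language of the structure induced on a subset `P` of an `L`-structure `M`: an `n`-ary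
relation symbol for each trace `D ∩ Pⁿ` on `Pⁿ` of a subset `D` of `Mⁿ` that is definable in `M`
with parameters. -/
def inducedLanguage (L : Language) {M : Type*} [L.Structure M] (P : Set M) : Language where
  Functions := fun _ => Empty
  Relations := fun n => {R : Set (Fin n → P) //
    ∃ D : Set (Fin n → M), (Set.univ : Set M).Definable L D ∧ R = {x | (fun i => (x i : M)) ∈ D}}

/-- The structure induced on a subset `P` of an `L`-structure `M`. -/
instance (L : Language) {M : Type*} [L.Structure M] (P : Set M) :
    (inducedLanguage L P).Structure P where
  funMap {_} f := Empty.elim f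
  RelMap {_} R := fun x => x ∈ R.1

/-- An `L`-structure `M` with a linear order is o-minimal: the order is definable (without
parameters), and every subset of `M` that is definable with parameters is a finite union of points
and of open intervals with endpoints in `M ∪ {-∞, ∞}`. -/
def IsOMinimal (L : Language) (M : Type*) [LinearOrder M] [L.Structure M] : Prop :=
  (∅ : Set M).Definable L {x : Fin 2 → M | x 0 < x 1} ∧
  ∀ A : Set M, (Set.univ : Set M).Definable₁ L A →
    ∃ F : Set (Set M), F.Finite ∧ A = ⋃₀ F ∧ ∀ I ∈ F,
      (∃ a, I = {a}) ∨ (∃ a b, I = Set.Ioo a b) ∨ (∃ a, I = Set.Ioi a) ∨ (∃ b, I = Set.Iio b) ∨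
        I = Set.univ

end Induced

end AsymptoticCouples

end

/-! A definable set is controlled by back-and-forth in an ultrapower `Δ` of `Γ` over `ℕ`. This is
again a model of `T_log`, and it is saturated for countable types. A partial automorphism is the
graph of a map between rational subspaces of `Δ` that preserves the order, `ψ`, `s` and `p`.

The algebraic core is the successor identity (`IsModelTlog.sub_of_succ_lt`): if `sα < sβ`, then `ψ(β
- α) = sα`. It makes the values and signs of linear combinations of elements of `Ψ` depend only on
the ordered set `Ψ` with its successor. Hence an order isomorphism between pieces of `Ψ` that is
closed under `s` and `p` and contains the `Ψ`-part of a partial automorphism extends that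
automorphism linearly (`matched_of_mem_sup_span`, `isPartialIso_sup_span`). To adjoin an arbitrary
element `a`, a countable subcouple containing `a` and the domain is fixed, and its whole `Ψ`-part is
adjoined first. After that `a` creates no new values, and its image is found by saturation
(`IsPartialIso.exists_add_element`).

By induction on formulas, sequences whose germs correspond satisfy the same formulas for almost all
indices (`eventually_realize_iff`). Elements of `Ψ` in the same cut over a countable subcouple do
correspond, so a diagonal argument shows that membership in a definable set depends, on `Ψ`, on only
finitely many conditions `e ≤ x` (`exists_finset_determining`). These cut `Ψ` into intervals `[e,
f)`.

For the induced structure, `Ψ` is itself definable, so sets definable in the induced structure are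
definable in the couple. -/

noncomputable section

namespace AsymptoticCouples

open AsymptoticCouple (psi)

/-! ### Values of sums and differences, and the successor identity -/

section Basic

variable {Δ : Type*} [AddCommGroup Δ] [LinearOrder Δ] [IsOrderedAddMonoid Δ] [AsymptoticCouple Δ]

theorem psi_neg {α : Δ} (hα : α ≠ 0) : psi (-α) = psi α := by
  simpa using AsymptoticCouple.ac2 α hα (-1) (by norm_num)

theorem psi_sub_comm {α β : Δ} (h : α ≠ β) : psi (α - β) = psi (β - α) := by
  rw [← psi_neg (sub_ne_zero.2 h), neg_sub]

theorem psi_mem_Psi {α : Δ} (hα : α ≠ 0) : psi α ∈ Psi Δ := ⟨α, hα, rfl⟩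

/-- The ultrametric inequality is applied to `x + y` and to `x = (x + y) + (-y)`. The premise `y ≠
0` in `h` plays the role of `ψ(0) = ∞`. -/
theorem psi_add_of_lt {x y : Δ} (hx : x ≠ 0) (h : y ≠ 0 → psi x < psi y) :
    x + y ≠ 0 ∧ psi (x + y) = psi x := by
  by_cases hy : y = 0
  · simp [hy, hx]
  have h := h hy
  have hne : x + y ≠ 0 := fun h0 => by
    rw [add_eq_zero_iff_eq_neg.1 h0, psi_neg hy] at h
    exact h.false
  refine ⟨hne, le_antisymm ?_ ?_⟩
  · have := AsymptoticCouple.ac1 (x + y) (-y) hne (neg_ne_zero.2 hy) (by simpa using hx)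
    rw [add_neg_cancel_right, psi_neg hy] at this
    exact (min_le_iff.1 this).resolve_right (not_le.2 h)
  · have := AsymptoticCouple.ac1 x y hx hy hne
    rwa [min_eq_left h.le] at this

/-- Otherwise `0 < x ≤ -y`, and `H`-type would give `ψ(y) ≤ ψ(x)`. -/
theorem IsHType.pos_add_of_lt (hH : IsHType Δ) {x y : Δ} (hx : 0 < x)
    (h : y ≠ 0 → psi x < psi y) : 0 < x + y := by
  by_contra! h0
  have h1 : x ≤ -y := by simpa using add_le_add_left h0 (-y)
  have hy : y ≠ 0 := by rintro rfl; simp at h1; exact h1.not_gt hx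
  have := hH x (-y) hx h1
  rw [psi_neg hy] at this
  exact this.not_gt (h hy)

theorem IsHType.pos_add_iff (hH : IsHType Δ) {x y : Δ} (hx : x ≠ 0)
    (h : y ≠ 0 → psi x < psi y) : 0 < x + y ↔ 0 < x := by
  refine ⟨fun h0 => ?_, fun h0 => hH.pos_add_of_lt h0 h⟩
  by_contra hx0
  have hx0 : 0 < -x := by simpa using lt_of_le_of_ne (not_lt.1 hx0) hx
  have := hH.pos_add_of_lt (y := -y) hx0 fun hy => by
    rw [psi_neg hx, psi_neg (by simpa using hy)]; exact h (by simpa using hy)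
  rw [← neg_add, neg_pos] at this
  exact this.not_gt h0

/-- With `v = ψ(β)`, the axiom `ψ(β) < (v - u) + ψ(v - u)` becomes the claim after cancelling `v`.
-/
theorem lt_psi_sub {u v : Δ} (hv : v ∈ Psi Δ) (h : u < v) : u < psi (v - u) := by
  obtain ⟨β, hβ, rfl⟩ := hv
  have hd : 0 < psi β - u := sub_pos.2 h
  have := AsymptoticCouple.ac3 (psi β - u) β hd.ne' hβ hd
  have h2 : psi β < psi β + (psi (psi β - u) - u) := by
    calc psi β < _ := this
      _ = _ := by abel
  simpa using h2

variable (hM : IsModelTlog Δ)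
include hM

/-- The difference `α - sα` is the integral of `α`. -/
theorem IsModelTlog.sub_succ_ne (α : Δ) : α - succ α ≠ 0 := by
  obtain ⟨h0, h1⟩ := integral_spec hM.asymptoticIntegration α
  have : α - succ α = integral α := sub_eq_of_eq_add h1.symm
  rwa [this]

theorem IsModelTlog.psi_sub_succ (α : Δ) : psi (α - succ α) = succ α := by
  obtain ⟨h0, h1⟩ := integral_spec hM.asymptoticIntegration α
  have : α - succ α = integral α := sub_eq_of_eq_add h1.symm
  rw [this]; rfl

/-- The hypotheses say that `α - u` is an integral of `α`, and integrals are unique. So `s` is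
determined by `ψ`, and maps preserving `ψ` can be shown to preserve `s`. -/
theorem IsModelTlog.succ_eq {α u : Δ} (h : α ≠ u) (h1 : psi (α - u) = u) : succ α = u := by
  have := integral_unique hM.hType hM.asymptoticIntegration (sub_ne_zero.2 h)
    (α := α) (by rw [h1]; abel)
  rw [succ, this, h1]

theorem IsModelTlog.succ_mem (α : Δ) : succ α ∈ Psi Δ :=
  ⟨_, (integral_spec hM.asymptoticIntegration α).1, rfl⟩

theorem IsModelTlog.succ_lt_succ {u v : Δ} (hu : u ∈ Psi Δ) (hv : v ∈ Psi Δ) (h : u < v) :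
    succ u < succ v :=
  ((hM.succ_spec u hu).2.2 v hv h).trans_lt (hM.succ_spec v hv).2.1

theorem IsModelTlog.succ_lt_succ_iff {u v : Δ} (hu : u ∈ Psi Δ) (hv : v ∈ Psi Δ) :
    succ u < succ v ↔ u < v := by
  refine ⟨fun h => ?_, hM.succ_lt_succ hu hv⟩
  by_contra! h1
  rcases h1.lt_or_eq with h1 | h1
  · exact (hM.succ_lt_succ hv hu h1).not_gt h
  · exact h.ne (by rw [h1])

theorem IsModelTlog.succ_inj {u v : Δ} (hu : u ∈ Psi Δ) (hv : v ∈ Psi Δ) (h : succ u = succ v) :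
    u = v := hM.succ_bij.injOn hu hv h

theorem IsModelTlog.exists_pred {u : Δ} (hu : u ∈ Psi Δ) (h : u ≠ succ 0) :
    ∃ v ∈ Psi Δ, succ v = u :=
  hM.succ_bij.surjOn ⟨hu, lt_of_le_of_ne (hM.isLeast.2 hu) h.symm⟩

theorem IsModelTlog.sub_succ_neg {u : Δ} (hu : u ∈ Psi Δ) : u - succ u < 0 :=
  sub_neg.2 (hM.succ_spec u hu).2.1

/-- The successor identity. -/
theorem IsModelTlog.sub_of_succ_lt {α β : Δ} (h : succ α < succ β) :
    β ≠ α ∧ psi (β - α) = succ α ∧ (0 < β - α ↔ α - succ α < 0) := by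
  have h1 : -(α - succ α) ≠ 0 := neg_ne_zero.2 (hM.sub_succ_ne α)
  have h2 : psi (-(α - succ α)) = succ α := by
    rw [psi_neg (hM.sub_succ_ne α), hM.psi_sub_succ]
  have h3 := lt_psi_sub (hM.succ_mem β) h
  -- In terms of integrals, `β - α = -∫α + (∫β + (sβ - sα))`. The value of `∫α` is `sα`, while `∫β`
  -- and `sβ - sα` have larger values, so `-∫α` decides both the value and the sign.
  have h4 : β - α = -(α - succ α) + ((β - succ β) + (succ β - succ α)) := by abel
  have h5 : (β - succ β) + (succ β - succ α) ≠ 0 →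
      psi (-(α - succ α)) < psi ((β - succ β) + (succ β - succ α)) := fun h0 => by
    rw [h2]
    refine lt_of_lt_of_le ?_ (AsymptoticCouple.ac1 _ _ (hM.sub_succ_ne β) (sub_pos.2 h).ne' h0)
    rw [hM.psi_sub_succ]
    exact lt_min h h3
  obtain ⟨h6, h7⟩ := psi_add_of_lt h1 h5
  have h8 := hM.hType.pos_add_iff h1 h5
  rw [← h4] at h6 h7 h8
  exact ⟨sub_ne_zero.1 h6, h7.trans h2, by rw [h8, neg_pos]⟩

theorem IsModelTlog.psi_succ_zero : psi (succ (0 : Δ)) = succ 0 := by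
  have h := hM.psi_sub_succ (0 : Δ)
  rwa [zero_sub, psi_neg hM.succ_zero_pos.ne'] at h

/-- Each element of `Ψ` is the value of an element definable from it. -/
theorem IsModelTlog.psi_sub_of_succ_eq {u v : Δ} (h : succ v = u) : psi (v - u) = u := by
  rw [← h, hM.psi_sub_succ]

end Basic

/-! ### Rational scalars, order and values -/

section Rational

variable {Δ : Type*} [AddCommGroup Δ] [LinearOrder Δ] [IsOrderedAddMonoid Δ] [AsymptoticCouple Δ]
  [Module ℚ Δ]

omit [LinearOrder Δ] [IsOrderedAddMonoid Δ] [AsymptoticCouple Δ] in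
theorem den_zsmul_rat_smul (q : ℚ) (x : Δ) : (q.den : ℤ) • (q • x) = q.num • x := by
  rw [← Int.cast_smul_eq_zsmul ℚ, ← Int.cast_smul_eq_zsmul ℚ, smul_smul]
  congr 1
  rw [mul_comm]; exact_mod_cast Rat.mul_den_eq_num q

theorem psi_rat_smul {q : ℚ} (hq : q ≠ 0) {x : Δ} (hx : x ≠ 0) : psi (q • x) = psi x := by
  have h := AsymptoticCouple.ac2 (q • x) (smul_ne_zero hq hx) (q.den : ℤ) (by simp)
  rw [den_zsmul_rat_smul, AsymptoticCouple.ac2 x hx _ (by simpa using hq)] at h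
  exact h.symm

omit [AsymptoticCouple Δ] in
theorem rat_smul_pos {q : ℚ} (hq : 0 < q) {x : Δ} (hx : 0 < x) : 0 < q • x := by
  have h : 0 < (q.den : ℤ) • (q • x) := by
    rw [den_zsmul_rat_smul]; exact zsmul_pos hx (by simpa using hq)
  by_contra! h0
  rw [natCast_zsmul] at h
  exact (nsmul_nonpos h0 _).not_gt h

omit [AsymptoticCouple Δ] in
theorem rat_smul_pos_iff {q : ℚ} (hq : q ≠ 0) {x : Δ} :
    0 < q • x ↔ (0 < q ∧ 0 < x) ∨ (q < 0 ∧ x < 0) := by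
  have key : ∀ {q : ℚ} (_ : 0 < q) {x : Δ}, 0 < q • x ↔ 0 < x := fun {q} hq {x} =>
    ⟨fun h => by simpa [smul_smul, hq.ne'] using rat_smul_pos (inv_pos.2 hq) h, rat_smul_pos hq⟩
  rcases hq.lt_or_gt with h | h
  · rw [← neg_smul_neg, key (neg_pos.2 h)]
    simp [h, h.not_gt]
  · simp [key h, h, h.not_gt]

end Rational

/-! ### Partial automorphisms of the ordered set `Ψ` with its successor -/

section PsiIso

variable {Δ : Type*} [AddCommGroup Δ] [LinearOrder Δ] [IsOrderedAddMonoid Δ] [AsymptoticCouple Δ]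

/-- Partial automorphisms of the ordered set `Ψ`, given by their graphs, whose domain and range
are closed under successors and predecessors. -/
structure IsPsiIso (P : Set (Δ × Δ)) : Prop where
  mem : ∀ z ∈ P, z.1 ∈ Psi Δ ∧ z.2 ∈ Psi Δ
  lt_iff : ∀ z ∈ P, ∀ w ∈ P, z.1 < w.1 ↔ z.2 < w.2
  succ_mem : ∀ z ∈ P, (succ z.1, succ z.2) ∈ P
  pred_mem : ∀ u ∈ Psi Δ, ∀ v ∈ Psi Δ, (succ u, succ v) ∈ P →
    (u, v) ∈ P
  zero_mem : (succ 0, succ 0) ∈ P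

theorem IsPsiIso.eq_iff {P : Set (Δ × Δ)} (hP : IsPsiIso P) {z w : Δ × Δ} (hz : z ∈ P)
    (hw : w ∈ P) : z.1 = w.1 ↔ z.2 = w.2 := by
  have h1 := hP.lt_iff z hz w hw
  have h2 := hP.lt_iff w hw z hz
  constructor <;> intro h
  · rw [h] at h1 h2
    exact le_antisymm (not_lt.1 fun h3 => lt_irrefl _ (h2.2 h3))
      (not_lt.1 fun h3 => lt_irrefl _ (h1.2 h3))
  · rw [h] at h1 h2
    exact le_antisymm (not_lt.1 fun h3 => lt_irrefl _ (h2.1 h3))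
      (not_lt.1 fun h3 => lt_irrefl _ (h1.1 h3))

theorem IsPsiIso.swap {P : Set (Δ × Δ)} (hP : IsPsiIso P) : IsPsiIso (Prod.swap ⁻¹' P) where
  mem _ hz := (hP.mem _ hz).symm
  lt_iff _ hz _ hw := (hP.lt_iff _ hz _ hw).symm
  succ_mem _ hz := hP.succ_mem _ hz
  pred_mem u hu v hv h := hP.pred_mem v hv u hu h
  zero_mem := hP.zero_mem

/-- `b` and `b'` realize corresponding cuts in the domain and the range of `P`. -/
def CutMatch (P : Set (Δ × Δ)) (b b' : Δ) : Prop :=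
  ∀ z ∈ P, z.1 ≠ b ∧ z.2 ≠ b' ∧ (z.1 < b ↔ z.2 < b')

/-- The pairs of elements of `Ψ` at the same finite distance from `b` and `b'`. -/
def orbit (b b' : Δ) : Set (Δ × Δ) :=
  {z | z.1 ∈ Psi Δ ∧ z.2 ∈ Psi Δ ∧
    ∃ m n : ℕ, succ^[m] z.1 = succ^[n] b ∧ succ^[m] z.2 = succ^[n] b'}

theorem mem_orbit_self {b b' : Δ} (hb : b ∈ Psi Δ) (hb' : b' ∈ Psi Δ) : (b, b') ∈ orbit b b' :=
  ⟨hb, hb', 0, 0, rfl, rfl⟩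

variable (hM : IsModelTlog Δ)
include hM

theorem IsModelTlog.iterate_succ_mem {u : Δ} (hu : u ∈ Psi Δ) (n : ℕ) :
    succ^[n] u ∈ Psi Δ := by
  cases n with
  | zero => exact hu
  | succ n => rw [Function.iterate_succ_apply']; exact hM.succ_mem _

theorem IsModelTlog.iterate_succ_lt_iff {u v : Δ} (hu : u ∈ Psi Δ) (hv : v ∈ Psi Δ) (n : ℕ) :
    succ^[n] u < succ^[n] v ↔ u < v := by
  induction n with
  | zero => rfl
  | succ n ih =>
    rw [Function.iterate_succ_apply', Function.iterate_succ_apply',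
      hM.succ_lt_succ_iff (hM.iterate_succ_mem hu n) (hM.iterate_succ_mem hv n), ih]

theorem IsModelTlog.iterate_succ_strictMono {u : Δ} (hu : u ∈ Psi Δ) :
    StrictMono fun n : ℕ => succ^[n] u :=
  strictMono_nat_of_lt_succ fun n => by
    rw [Function.iterate_succ_apply']
    exact (hM.succ_spec _ (hM.iterate_succ_mem hu n)).2.1

theorem IsModelTlog.lt_succ_iff {u v : Δ} (hu : u ∈ Psi Δ) (hv : v ∈ Psi Δ) (h : u ≠ v) :
    u < succ v ↔ u < v := by
  refine ⟨fun h1 => ?_, fun h1 => h1.trans (hM.succ_spec v hv).2.1⟩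
  by_contra! h2
  exact ((hM.succ_spec v hv).2.2 u hu (lt_of_le_of_ne h2 h.symm)).not_gt h1

theorem IsModelTlog.succ_zero_lt_succ {u : Δ} (hu : u ∈ Psi Δ) : succ 0 < succ u :=
  (hM.isLeast.2 hu).trans_lt (hM.succ_spec u hu).2.1

/-- If `succ b` were in the domain, its image would differ from `succ 0`, which corresponds only to
`succ 0`. The image would then have a predecessor, and closure under predecessors would put `b` in
the domain. -/
theorem IsPsiIso.fst_ne_succ {P : Set (Δ × Δ)} (hP : IsPsiIso P) {b : Δ} (hb : b ∈ Psi Δ)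
    (h : ∀ z ∈ P, z.1 ≠ b) : ∀ z ∈ P, z.1 ≠ succ b := by
  intro z hz h1
  have h2 : z.2 ≠ succ 0 := fun h2 => by
    have := (hP.eq_iff hz hP.zero_mem).2 h2
    exact (hM.succ_zero_lt_succ hb).ne (this.symm.trans h1)
  obtain ⟨v, hv, h3⟩ := hM.exists_pred (hP.mem z hz).2 h2
  have h4 : z = (succ b, succ v) := Prod.ext h1 h3.symm
  exact h _ (hP.pred_mem b hb v hv (h4 ▸ hz)) rfl

/-- No element of `Ψ` lies strictly between a point and its successor, so shifting both points by
`s` leaves the cut unchanged. -/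
theorem CutMatch.succ_right {P : Set (Δ × Δ)} (hP : IsPsiIso P) {b b' : Δ} (hb : b ∈ Psi Δ)
    (hb' : b' ∈ Psi Δ) (h : CutMatch P b b') :
    CutMatch P (succ b) (succ b') := by
  intro z hz
  refine ⟨hP.fst_ne_succ hM hb (fun z hz => (h z hz).1) z hz,
    hP.swap.fst_ne_succ hM hb' (fun w hw => (h _ hw).2.1) z.swap (by simpa using hz), ?_⟩
  rw [hM.lt_succ_iff (hP.mem z hz).1 hb (h z hz).1,
    hM.lt_succ_iff (hP.mem z hz).2 hb' (h z hz).2.1]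
  exact (h z hz).2.2

theorem CutMatch.iterate {P : Set (Δ × Δ)} (hP : IsPsiIso P) {b b' : Δ} (hb : b ∈ Psi Δ)
    (hb' : b' ∈ Psi Δ) (h : CutMatch P b b') (n : ℕ) :
    CutMatch P (succ^[n] b) (succ^[n] b') := by
  induction n with
  | zero => exact h
  | succ n ih =>
    rw [Function.iterate_succ_apply', Function.iterate_succ_apply']
    exact ih.succ_right hM hP (hM.iterate_succ_mem hb n) (hM.iterate_succ_mem hb' n)

omit hM in
theorem IsPsiIso.iterate_mem {P : Set (Δ × Δ)} (hP : IsPsiIso P) {z : Δ × Δ} (hz : z ∈ P)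
    (n : ℕ) : (succ^[n] z.1, succ^[n] z.2) ∈ P := by
  induction n with
  | zero => exact hz
  | succ n ih =>
    rw [Function.iterate_succ_apply', Function.iterate_succ_apply']
    exact hP.succ_mem _ ih

/-- Since `s` is strictly increasing on `Ψ`, comparisons may be made after applying a power of it. A
point of `P` is thereby compared with an iterate of `b`, whose cut still matches. Two orbit points,
shifted by `m' + m`, become iterates of `b`, ordered by their exponents. -/
theorem IsPsiIso.union_orbit {P : Set (Δ × Δ)} (hP : IsPsiIso P) {b b' : Δ} (hb : b ∈ Psi Δ)
    (hb' : b' ∈ Psi Δ) (h : CutMatch P b b') : IsPsiIso (P ∪ orbit b b') := by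
  have key : ∀ z ∈ P, ∀ w ∈ orbit b b',
      (z.1 < w.1 ↔ z.2 < w.2) ∧ (w.1 < z.1 ↔ w.2 < z.2) := by
    rintro z hz w ⟨h1, h2, m, n, h3, h4⟩
    obtain ⟨h5, h6, h7⟩ := h.iterate hM hP hb hb' n _ (hP.iterate_mem hz m)
    rw [← hM.iterate_succ_lt_iff (hP.mem z hz).1 h1 m,
      ← hM.iterate_succ_lt_iff (hP.mem z hz).2 h2 m,
      ← hM.iterate_succ_lt_iff h1 (hP.mem z hz).1 m,
      ← hM.iterate_succ_lt_iff h2 (hP.mem z hz).2 m, h3, h4]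
    refine ⟨h7, ?_⟩
    rw [← not_iff_not, not_lt, not_lt, le_iff_lt_or_eq, le_iff_lt_or_eq, or_iff_left h5,
      or_iff_left h6]
    exact h7
  refine ⟨?_, ?_, ?_, ?_, Or.inl hP.zero_mem⟩
  · rintro z (hz | hz)
    · exact hP.mem z hz
    · exact ⟨hz.1, hz.2.1⟩
  · rintro z (hz | hz) w (hw | hw)
    · exact hP.lt_iff z hz w hw
    · exact (key z hz w hw).1
    · exact (key w hw z hz).2
    · obtain ⟨h1, h2, m, n, h3, h4⟩ := hz
      obtain ⟨h1', h2', m', n', h3', h4'⟩ := hw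
      rw [← hM.iterate_succ_lt_iff h1 h1' (m' + m), ← hM.iterate_succ_lt_iff h2 h2' (m' + m),
        Function.iterate_add_apply, Function.iterate_add_apply _ m' m z.2, h3, h4,
        add_comm m' m, Function.iterate_add_apply, Function.iterate_add_apply _ m m' w.2, h3', h4',
        ← Function.iterate_add_apply, ← Function.iterate_add_apply, ← Function.iterate_add_apply,
        ← Function.iterate_add_apply, (hM.iterate_succ_strictMono hb).lt_iff_lt,
        (hM.iterate_succ_strictMono hb').lt_iff_lt]
  · rintro z (hz | ⟨h1, h2, m, n, h3, h4⟩)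
    · exact Or.inl (hP.succ_mem z hz)
    · refine Or.inr ⟨hM.succ_mem _, hM.succ_mem _, m, n + 1, ?_, ?_⟩
      · rw [Function.iterate_succ_apply', ← h3, ← Function.iterate_succ_apply,
          Function.iterate_succ_apply']
      · rw [Function.iterate_succ_apply', ← h4, ← Function.iterate_succ_apply,
          Function.iterate_succ_apply']
  · rintro u hu v hv (hz | ⟨h1, h2, m, n, h3, h4⟩)
    · exact Or.inl (hP.pred_mem u hu v hv hz)
    · exact Or.inr ⟨hu, hv, m + 1, n, h3, h4⟩

end PsiIso

/-! ### Extending partial automorphisms of `Ψ` by saturation -/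

section Saturation

variable (Δ : Type*) [AddCommGroup Δ] [LinearOrder Δ] [IsOrderedAddMonoid Δ] [AsymptoticCouple Δ]

/-- The instances of `ℵ₁`-saturation used for extending partial isomorphisms. -/
structure IsCountablySaturated : Prop where
  exists_mem_Psi : ∀ (e : ℕ → Δ) (t : ℕ → Prop),
    (∀ N, ∃ x ∈ Psi Δ, ∀ n ≤ N, x ≠ e n ∧ (e n < x ↔ t n)) →
    ∃ x ∈ Psi Δ, ∀ n, x ≠ e n ∧ (e n < x ↔ t n)
  exists_psi_sub : ∀ (e γ : ℕ → Δ) (t : ℕ → Prop),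
    (∀ N, ∃ x, ∀ n ≤ N, x ≠ e n ∧ (e n < x ↔ t n) ∧ psi (x - e n) = γ n) →
    ∃ x, ∀ n, x ≠ e n ∧ (e n < x ↔ t n) ∧ psi (x - e n) = γ n

variable {Δ} (hM : IsModelTlog Δ) (hS : IsCountablySaturated Δ)
include hM hS

theorem IsPsiIso.exists_cutMatch {P : Set (Δ × Δ)} (hP : IsPsiIso P) (hc : P.Countable) {b : Δ}
    (hb : b ∈ Psi Δ) (h : ∀ z ∈ P, z.1 ≠ b) : ∃ b' ∈ Psi Δ, CutMatch P b b' := by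
  classical
  obtain ⟨f, rfl⟩ := hc.exists_eq_range ⟨_, hP.zero_mem⟩
  have hf : ∀ n, f n ∈ Set.range f := fun n => ⟨n, rfl⟩
  obtain ⟨x, hx, h1⟩ := hS.exists_mem_Psi (fun n => (f n).2) (fun n => (f n).1 < b) (fun N => by
    -- The pair of least elements is inserted so that some point of `S` lies below `b`.
    let S := (insert ((succ 0, succ 0) : Δ × Δ)
      ((Finset.range (N + 1)).image f)).filter fun z => z.1 < b
    have h0 : ((succ 0, succ 0) : Δ × Δ) ∈ S := by
      simp only [S, Finset.mem_filter, Finset.mem_insert, true_or, true_and]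
      exact lt_of_le_of_ne (hM.isLeast.2 hb) (h _ hP.zero_mem)
    obtain ⟨w, hw, hmax⟩ := S.exists_max_image Prod.fst ⟨_, h0⟩
    have hwP : w ∈ Set.range f := by
      simp only [S, Finset.mem_filter, Finset.mem_insert, Finset.mem_image] at hw
      rcases hw.1 with rfl | ⟨n, -, rfl⟩
      · exact hP.zero_mem
      · exact hf n
    have hwb : w.1 < b := (Finset.mem_filter.1 hw).2
    have hsb : succ w.1 < b := lt_of_le_of_ne
      ((hM.succ_spec _ (hP.mem w hwP).1).2.2 b hb hwb) (h _ (hP.succ_mem w hwP))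
    -- The point `succ w.1` lies strictly between `w.1` and `b`, hence is none of the finitely many
    -- given points, and it is in the domain. Its image realizes the finite cut.
    refine ⟨succ w.2, hM.succ_mem _, fun n hn => ?_⟩
    by_cases hnb : (f n).1 < b
    · have h2 : (f n).1 ≤ w.1 := hmax (f n) (Finset.mem_filter.2 ⟨Finset.mem_insert_of_mem
        (Finset.mem_image_of_mem f (Finset.mem_range.2 (by omega))), hnb⟩)
      have h3 : (f n).2 ≤ w.2 := by
        rw [← not_lt, ← hP.lt_iff w hwP _ (hf n), not_lt]; exact h2
      have h4 := h3.trans_lt (hM.succ_spec _ (hP.mem w hwP).2).2.1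
      exact ⟨h4.ne', iff_of_true h4 hnb⟩
    · have h2 : succ w.1 < (f n).1 := hsb.trans_le (not_lt.1 hnb)
      have h3 := (hP.lt_iff _ (hP.succ_mem w hwP) _ (hf n)).1 h2
      exact ⟨h3.ne, iff_of_false h3.not_gt hnb⟩)
  refine ⟨x, hx, ?_⟩
  rintro _ ⟨n, rfl⟩
  exact ⟨h _ (hf n), (h1 n).1.symm, (h1 n).2.symm⟩

/-- Partial automorphisms of `Ψ` extend to countable sets closed under successors and
predecessors. -/
theorem IsPsiIso.exists_extension {P : Set (Δ × Δ)} (hP : IsPsiIso P) {C : Set Δ}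
    (hC : C.Countable) (hs : ∀ x ∈ C, succ x ∈ C)
    (hp : ∀ u ∈ Psi Δ, succ u ∈ C → u ∈ C) (hPC : ∀ z ∈ P, z.1 ∈ C) :
    ∃ P', P ⊆ P' ∧ IsPsiIso P' ∧ (∀ z ∈ P', z.1 ∈ C) ∧
      ∀ b ∈ C, b ∈ Psi Δ → ∃ v, (b, v) ∈ P' := by
  obtain ⟨Q, hPQ, hQ⟩ := zorn_subset_nonempty {Q : Set (Δ × Δ) | IsPsiIso Q ∧ ∀ z ∈ Q, z.1 ∈ C}
    (by
      intro c hc hchain ⟨Q₀, hQ₀⟩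
      refine ⟨⋃₀ c, ⟨⟨?_, ?_, ?_, ?_, Set.mem_sUnion_of_mem (hc hQ₀).1.zero_mem hQ₀⟩, ?_⟩,
        fun s hs => Set.subset_sUnion_of_mem hs⟩
      · rintro z ⟨Q, hQ, hz⟩
        exact (hc hQ).1.mem z hz
      · rintro z ⟨Q, hQ, hz⟩ w ⟨R, hR, hw⟩
        rcases hchain.total hQ hR with h | h
        · exact (hc hR).1.lt_iff z (h hz) w hw
        · exact (hc hQ).1.lt_iff z hz w (h hw)
      · rintro z ⟨Q, hQ, hz⟩
        exact ⟨Q, hQ, (hc hQ).1.succ_mem z hz⟩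
      · rintro u hu v hv ⟨Q, hQ, hz⟩
        exact ⟨Q, hQ, (hc hQ).1.pred_mem u hu v hv hz⟩
      · rintro z ⟨Q, hQ, hz⟩
        exact (hc hQ).2 z hz) P ⟨hP, hPC⟩
  refine ⟨Q, hPQ, hQ.prop.1, hQ.prop.2, fun b hbC hb => ?_⟩
  by_contra! hcon
  -- The first projection is injective on `Q` with image in `C`, so saturation supplies a partner
  -- for the missing `b`. Adjoining the orbit contradicts maximality.
  have hQc : Q.Countable := by
    refine Set.MapsTo.countable_of_injOn (f := Prod.fst) hQ.prop.2 ?_ hC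
    intro z hz w hw h
    exact Prod.ext h ((hQ.prop.1.eq_iff hz hw).1 h)
  obtain ⟨b', hb', hm⟩ := hQ.prop.1.exists_cutMatch hM hS hQc hb fun z hz h =>
    hcon z.2 (by rw [← h]; exact hz)
  have hiter : ∀ n : ℕ, succ^[n] b ∈ C := fun n => by
    induction n with
    | zero => exact hbC
    | succ n ih => rw [Function.iterate_succ_apply']; exact hs _ ih
  have hback : ∀ (m : ℕ) (u : Δ), u ∈ Psi Δ → succ^[m] u ∈ C → u ∈ C :=
    fun m => by
      induction m with
      | zero => exact fun u _ h => h
      | succ m ih => exact fun u hu h => hp u hu (ih _ (hM.succ_mem u) h)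
  refine hcon b' (hQ.le_of_ge (y := Q ∪ orbit b b') ⟨hQ.prop.1.union_orbit hM hb hb' hm, ?_⟩
    Set.subset_union_left (Or.inr (mem_orbit_self hb hb')))
  rintro z (hz | ⟨h1, h2, m, n, h3, h4⟩)
  · exact hQ.prop.2 z hz
  · exact hback m _ h1 (h3 ▸ hiter n)

end Saturation

/-! ### Countable subcouples -/

section Subcouple

variable {Δ : Type*} [AddCommGroup Δ] [LinearOrder Δ] [IsOrderedAddMonoid Δ] [AsymptoticCouple Δ]
  [Module ℚ Δ]

/-- The rational subspaces closed under `ψ`, `s` and `p`. -/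
structure IsSubcouple (C : Submodule ℚ Δ) : Prop where
  psi_mem : ∀ x ∈ C, x ≠ 0 → psi x ∈ C
  succ_mem : ∀ x ∈ C, succ x ∈ C
  pred_mem : ∀ u ∈ Psi Δ, succ u ∈ C → u ∈ C

instance : Countable (Σ n, Llog.Functions n) := by
  let f : (Σ n, Llog.Functions n) → ℕ := fun x => match x with
    | ⟨_, LlogFunc.zero⟩ => 0
    | ⟨_, LlogFunc.infty⟩ => 1
    | ⟨_, LlogFunc.neg⟩ => 2
    | ⟨_, LlogFunc.psi⟩ => 3
    | ⟨_, LlogFunc.succ⟩ => 4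
    | ⟨_, LlogFunc.pred⟩ => 5
    | ⟨_, LlogFunc.add⟩ => 6
    | ⟨_, LlogFunc.delta n⟩ => 7 + (n : ℕ)
  refine Function.Injective.countable (f := f) ?_
  rintro ⟨_, x⟩ ⟨_, y⟩ h
  cases x <;> cases y <;> simp only [f] at h <;> first | rfl | omega | skip
  have : (_ : ℕ+) = _ := PNat.coe_injective (Nat.add_left_cancel h)
  rw [this]

omit [LinearOrder Δ] [IsOrderedAddMonoid Δ] [AsymptoticCouple Δ] in
theorem divNat_eq {n : ℕ} (hn : n ≠ 0) (x : Δ) : divNat n x = (n : ℚ)⁻¹ • x := by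
  have hinj : Function.Injective fun γ : Δ => n • γ := fun a b h => by
    simp only [← Nat.cast_smul_eq_nsmul ℚ] at h
    exact (smul_right_injective Δ (Nat.cast_ne_zero.2 hn : (n : ℚ) ≠ 0)) h
  have h : n • ((n : ℚ)⁻¹ • x) = x := by
    rw [← Nat.cast_smul_eq_nsmul ℚ, smul_smul, mul_inv_cancel₀ (Nat.cast_ne_zero.2 hn), one_smul]
  conv_lhs => rw [← h]
  exact Function.leftInverse_invFun hinj _

omit [Module ℚ Δ] in
theorem pred_coe_succ (hM : IsModelTlog Δ) {u : Δ} (hu : u ∈ Psi Δ) :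
    pred ((succ u : Δ) : WithTop Δ) = (u : WithTop Δ) := by
  have h : succ u ∈ Psi Δ ∧ succ 0 < succ u := ⟨hM.succ_mem u, hM.succ_zero_lt_succ hu⟩
  simp only [pred, if_pos h]
  congr 1
  exact hM.succ_bij.injOn.leftInvOn_invFunOn hu

omit [Module ℚ Δ] in
theorem psiTop_coe {x : Δ} (hx : x ≠ 0) : psiTop (x : WithTop Δ) = (psi x : Δ) := by
  simp [psiTop, hx]

/-- The finite elements of the substructure generated by `B` work: the symbols `δ_n` make them a
rational subspace, and the symbol `p` gives closure under predecessors. -/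
theorem IsModelTlog.exists_countable_subcouple (hM : IsModelTlog Δ) {B : Set Δ}
    (hB : B.Countable) :
    ∃ C : Submodule ℚ Δ, IsSubcouple C ∧ (C : Set Δ).Countable ∧ B ⊆ C := by
  let S := Language.Substructure.closure Llog ((fun x : Δ => (x : WithTop Δ)) '' B)
  have hS : Countable S := (hB.image _).substructure_closure Llog
  have hadd : ∀ {a b : Δ}, (a : WithTop Δ) ∈ S → (b : WithTop Δ) ∈ S →
      ((a + b : Δ) : WithTop Δ) ∈ S := fun {a b} ha hb =>
    S.fun_mem (LlogFunc.add : Llog.Functions 2) ![a, b] (by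
      intro i; fin_cases i <;> assumption)
  have hun : ∀ (f : Llog.Functions 1) {a : WithTop Δ}, a ∈ S →
      Language.Structure.funMap f ![a] ∈ S := fun f a ha =>
    S.fun_mem f ![a] (by intro i; fin_cases i; exact ha)
  have hzero : ((0 : Δ) : WithTop Δ) ∈ S :=
    S.fun_mem (LlogFunc.zero : Llog.Functions 0) ![] (fun i => i.elim0)
  have hnsmul : ∀ (n : ℕ) {a : Δ}, (a : WithTop Δ) ∈ S → ((n • a : Δ) : WithTop Δ) ∈ S := by
    intro n a ha
    induction n with
    | zero => simpa using hzero
    | succ n ih => rw [succ_nsmul]; exact hadd ih ha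
  have hneg : ∀ {a : Δ}, (a : WithTop Δ) ∈ S → ((-a : Δ) : WithTop Δ) ∈ S :=
    fun ha => hun LlogFunc.neg ha
  have hzsmul : ∀ (n : ℤ) {a : Δ}, (a : WithTop Δ) ∈ S → ((n • a : Δ) : WithTop Δ) ∈ S := by
    intro n a ha
    obtain ⟨n, rfl | rfl⟩ := n.eq_nat_or_neg
    · rw [natCast_zsmul]; exact hnsmul n ha
    · rw [neg_smul, natCast_zsmul]; exact hneg (hnsmul n ha)
  have hsmul : ∀ (q : ℚ) {a : Δ}, (a : WithTop Δ) ∈ S → ((q • a : Δ) : WithTop Δ) ∈ S := by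
    intro q a ha
    have h1 : ((divNat q.den (q.num • a) : Δ) : WithTop Δ) ∈ S :=
      hun (LlogFunc.delta ⟨q.den, q.den_pos⟩) (hzsmul q.num ha)
    rw [divNat_eq q.den_nz, ← Int.cast_smul_eq_zsmul ℚ, smul_smul] at h1
    have h2 : ((q.den : ℚ)⁻¹ * (q.num : ℚ)) = q := by
      rw [mul_comm, ← div_eq_mul_inv, Rat.num_div_den]
    rwa [h2] at h1
  refine ⟨⟨⟨⟨{x : Δ | (x : WithTop Δ) ∈ S}, hadd⟩, hzero⟩, fun q a ha => hsmul q ha⟩,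
    ⟨fun x hx h0 => ?_, fun x hx => ?_, fun u hu hx => ?_⟩, ?_, ?_⟩
  · have h := hun LlogFunc.psi hx
    change psiTop (x : WithTop Δ) ∈ S at h
    rwa [psiTop_coe h0] at h
  · exact hun LlogFunc.succ hx
  · have h := hun LlogFunc.pred hx
    change pred ((succ u : Δ) : WithTop Δ) ∈ S at h
    rwa [pred_coe_succ hM hu] at h
  · exact Set.MapsTo.countable_of_injOn (f := fun x : Δ => (x : WithTop Δ)) (t := (S : Set _))
      (fun x hx => hx) (WithTop.coe_injective.injOn) (Set.to_countable _)
  · exact fun x hx => Language.Substructure.subset_closure ⟨x, hx, rfl⟩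

end Subcouple

/-! ### Extending partial automorphisms of the couple by elements of `Ψ` -/

section PartialIso

variable {Δ : Type*} [AddCommGroup Δ] [LinearOrder Δ] [IsOrderedAddMonoid Δ] [AsymptoticCouple Δ]
  [Module ℚ Δ]

/-- Partial automorphisms of an asymptotic couple, given by their graphs. -/
structure IsPartialIso (G : Submodule ℚ (Δ × Δ)) : Prop where
  pos_iff : ∀ z ∈ G, 0 < z.1 ↔ 0 < z.2
  psi_mem : ∀ z ∈ G, z.1 ≠ 0 → (psi z.1, psi z.2) ∈ G
  succ_mem : ∀ z ∈ G, (succ z.1, succ z.2) ∈ G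
  pred_mem : ∀ u ∈ Psi Δ, ∀ v ∈ Psi Δ, (succ u, succ v) ∈ G → (u, v) ∈ G

/-- The restriction of a partial automorphism to `Ψ`. -/
def psiPart (G : Submodule ℚ (Δ × Δ)) : Set (Δ × Δ) :=
  {z | z ∈ G ∧ z.1 ∈ Psi Δ ∧ z.2 ∈ Psi Δ}

/-- The two components of `z` are nonzero of the same sign, with values corresponding to each other
under `P`. -/
def Matched (P : Set (Δ × Δ)) (z : Δ × Δ) : Prop :=
  z.1 ≠ 0 ∧ z.2 ≠ 0 ∧ (0 < z.1 ↔ 0 < z.2) ∧ (psi z.1, psi z.2) ∈ P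

namespace IsPartialIso

variable {G : Submodule ℚ (Δ × Δ)} (hG : IsPartialIso G)
include hG

theorem lt_iff {z w : Δ × Δ} (hz : z ∈ G) (hw : w ∈ G) : z.1 < w.1 ↔ z.2 < w.2 := by
  rw [← sub_pos, ← sub_pos (a := w.2)]
  exact hG.pos_iff (w - z) (G.sub_mem hw hz)

theorem eq_iff {z w : Δ × Δ} (hz : z ∈ G) (hw : w ∈ G) : z.1 = w.1 ↔ z.2 = w.2 := by
  have h1 := hG.lt_iff hz hw
  have h2 := hG.lt_iff hw hz
  rw [eq_iff_le_not_lt, eq_iff_le_not_lt, ← not_lt, ← not_lt, h1, h2]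

theorem eq_of_fst_eq {z w : Δ × Δ} (hz : z ∈ G) (hw : w ∈ G) (h : z.1 = w.1) : z = w :=
  Prod.ext h ((hG.eq_iff hz hw).1 h)

theorem ne_zero_iff {z : Δ × Δ} (hz : z ∈ G) : z.1 ≠ 0 ↔ z.2 ≠ 0 :=
  not_congr (hG.eq_iff hz G.zero_mem)

theorem zero_mem : (succ 0, succ 0) ∈ G := hG.succ_mem 0 G.zero_mem

theorem swap : IsPartialIso (G.comap (LinearEquiv.prodComm ℚ Δ Δ).toLinearMap) where
  pos_iff _ hz := (hG.pos_iff _ hz).symm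
  psi_mem _ hz h := hG.psi_mem _ hz ((hG.ne_zero_iff hz).2 h)
  succ_mem _ hz := hG.succ_mem _ hz
  pred_mem u hu v hv h := hG.pred_mem v hv u hu h

theorem countable {C : Set Δ} (hC : C.Countable) (h : ∀ z ∈ G, z.1 ∈ C) :
    (G : Set (Δ × Δ)).Countable :=
  Set.MapsTo.countable_of_injOn (f := Prod.fst) h (fun _ hz _ hw h => hG.eq_of_fst_eq hz hw h) hC

variable (hM : IsModelTlog Δ)
include hM

/-- Since `succ 0 < succ z.1`, also `succ 0 < succ z.2`, so `succ z.2` is the successor of some `v ∈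
Ψ`. Closure under predecessors pairs `z.1` with `v`, whence `v = z.2`. -/
theorem snd_mem_Psi {z : Δ × Δ} (hz : z ∈ G) (h : z.1 ∈ Psi Δ) : z.2 ∈ Psi Δ := by
  have h1 := hG.succ_mem z hz
  have h2 := (hG.lt_iff hG.zero_mem h1).1 (hM.succ_zero_lt_succ h)
  obtain ⟨v, hv, h3⟩ := hM.exists_pred (hM.succ_mem z.2) h2.ne'
  have h4 := hG.pred_mem z.1 h v hv (by rw [h3]; exact h1)
  rw [hG.eq_of_fst_eq hz h4 rfl]
  exact hv

theorem isPsiIso : IsPsiIso (psiPart G) where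
  mem _ hz := hz.2
  lt_iff _ hz _ hw := hG.lt_iff hz.1 hw.1
  succ_mem z hz := ⟨hG.succ_mem z hz.1, hM.succ_mem _, hM.succ_mem _⟩
  pred_mem u hu v hv h := ⟨hG.pred_mem u hu v hv h.1, hu, hv⟩
  zero_mem := ⟨hG.zero_mem, hM.succ_mem _, hM.succ_mem _⟩

/-- The least element `s0` is its own value, and any other `su` is the value of `u - su`. This lets
types over the domain be approximated inside the domain. -/
theorem exists_psi_eq {z : Δ × Δ} (hz : z ∈ G) (h : z.1 ∈ Psi Δ) :
    ∃ w ∈ G, w.1 ≠ 0 ∧ psi w.1 = z.1 := by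
  by_cases h0 : z.1 = succ 0
  · refine ⟨z, hz, ?_, ?_⟩
    · rw [h0]; exact hM.succ_zero_pos.ne'
    · rw [h0, hM.psi_succ_zero]
  · obtain ⟨u, hu, h1⟩ := hM.exists_pred h h0
    have h2 : z.2 ≠ succ 0 := fun h2 => h0 ((hG.eq_iff hz hG.zero_mem).2 h2)
    obtain ⟨v, hv, h3⟩ := hM.exists_pred (hG.snd_mem_Psi hM hz h) h2
    have h4 : z = (succ u, succ v) := Prod.ext h1.symm h3.symm
    refine ⟨(u, v) - z, G.sub_mem (hG.pred_mem u hu v hv (h4 ▸ hz)) hz, ?_, ?_⟩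
    · rw [h4]; exact hM.sub_succ_ne u
    · exact hM.psi_sub_of_succ_eq h1

end IsPartialIso

omit [Module ℚ Δ] in
theorem Matched.neg {P : Set (Δ × Δ)} {z : Δ × Δ} (h : Matched P z) : Matched P (-z) := by
  obtain ⟨h1, h2, h3, h4⟩ := h
  refine ⟨neg_ne_zero.2 h1, neg_ne_zero.2 h2, ?_, ?_⟩
  · simp only [Prod.fst_neg, Prod.snd_neg, neg_pos]
    rw [lt_iff_le_and_ne, lt_iff_le_and_ne, ← not_lt, ← not_lt, h3]
    simp [h1, h2]
  · simpa [psi_neg h1, psi_neg h2] using h4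

theorem Matched.smul {P : Set (Δ × Δ)} {z : Δ × Δ} (h : Matched P z) {q : ℚ} (hq : q ≠ 0) :
    Matched P (q • z) := by
  have h' := h.neg
  obtain ⟨h1, h2, h3, h4⟩ := h
  have h5 : z.1 < 0 ↔ z.2 < 0 := by simpa using h'.2.2.1
  refine ⟨smul_ne_zero hq h1, smul_ne_zero hq h2, ?_, ?_⟩
  · rw [Prod.smul_fst, Prod.smul_snd, rat_smul_pos_iff hq, rat_smul_pos_iff hq, h3, h5]
  · rw [Prod.smul_fst, Prod.smul_snd, psi_rat_smul hq h1, psi_rat_smul hq h2]; exact h4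

omit [Module ℚ Δ] in
theorem Matched.add {P : Set (Δ × Δ)} (hP : IsPsiIso P) (hH : IsHType Δ) {z w : Δ × Δ}
    (hz : Matched P z) (hw : w ≠ 0 → Matched P w ∧ psi z.1 < psi w.1) :
    Matched P (z + w) ∧ psi (z + w).1 = psi z.1 := by
  by_cases h0 : w = 0
  · simpa [h0] using hz
  obtain ⟨hw, h⟩ := hw h0
  have h' := (hP.lt_iff _ hz.2.2.2 _ hw.2.2.2).1 h
  obtain ⟨h1, h2⟩ := psi_add_of_lt hz.1 fun _ => h
  obtain ⟨h3, h4⟩ := psi_add_of_lt hz.2.1 fun _ => h'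
  have h5 := hH.pos_add_iff hz.1 fun _ => h
  have h6 := hH.pos_add_iff hz.2.1 fun _ => h'
  refine ⟨⟨h1, h3, ?_, ?_⟩, h2⟩
  · exact h5.trans (hz.2.2.1.trans h6.symm)
  · rw [Prod.fst_add, Prod.snd_add, h2, h4]; exact hz.2.2.2

omit [Module ℚ Δ] in
-- The successor identity is used in both coordinates. The sign of the difference is opposite to
-- that of the integral of `z`, which is why `hs` is required.
theorem matched_sub {P : Set (Δ × Δ)} (hP : IsPsiIso P) (hM : IsModelTlog Δ) {z w : Δ × Δ}
    (hz : (succ z.1, succ z.2) ∈ P) (hw : (succ w.1, succ w.2) ∈ P) (h : succ z.1 < succ w.1)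
    (hs : z.1 - succ z.1 < 0 ↔ z.2 - succ z.2 < 0) :
    Matched P (w - z) ∧ psi (w - z).1 = succ z.1 := by
  obtain ⟨h1, h2, h3⟩ := hM.sub_of_succ_lt h
  obtain ⟨h4, h5, h6⟩ := hM.sub_of_succ_lt ((hP.lt_iff _ hz _ hw).1 h)
  refine ⟨⟨sub_ne_zero.2 h1, sub_ne_zero.2 h4, ?_, ?_⟩, h2⟩
  · exact h3.trans (hs.trans h6.symm)
  · rw [Prod.fst_sub, Prod.snd_sub, h2, h5]; exact hz

theorem IsPartialIso.matched {G : Submodule ℚ (Δ × Δ)} (hG : IsPartialIso G) {z : Δ × Δ}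
    (hz : z ∈ G) (h : z ≠ 0) : Matched (psiPart G) z := by
  have h1 : z.1 ≠ 0 := fun h0 => h (hG.eq_of_fst_eq hz G.zero_mem h0)
  have h2 := (hG.ne_zero_iff hz).1 h1
  exact ⟨h1, h2, hG.pos_iff z hz, hG.psi_mem z hz h1, psi_mem_Psi h1, psi_mem_Psi h2⟩

/-- Control of signs and values suffices. As `sα` is the only `u ≠ α` with `ψ(α - u) = u`,
preservation of `ψ` forces preservation of `s`. Predecessors are handled by `P`, since an element of
`G` is determined by its first coordinate. -/
theorem isPartialIso_of_matched {P : Set (Δ × Δ)} (hP : IsPsiIso P) (hM : IsModelTlog Δ)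
    {G : Submodule ℚ (Δ × Δ)} (hPG : P ⊆ G) (hm : ∀ z ∈ G, z ≠ 0 → Matched P z)
    (hs : ∀ z ∈ G, ∃ v, (succ z.1, v) ∈ P) (hd : ∀ z ∈ G, z.1 ∈ Psi Δ → ∃ v, (z.1, v) ∈ P) :
    IsPartialIso G where
  pos_iff z hz := by
    by_cases h : z = 0
    · simp [h]
    · exact (hm z hz h).2.2.1
  psi_mem z hz h := hPG (hm z hz (fun h0 => h (by simp [h0]))).2.2.2
  succ_mem z hz := by
    obtain ⟨v, hv⟩ := hs z hz
    have h1 : (z - (succ z.1, v)).1 ≠ 0 := hM.sub_succ_ne z.1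
    have h2 := hm (z - (succ z.1, v)) (G.sub_mem hz (hPG hv)) fun h0 => h1 (by simp [h0])
    have h3 := (hP.eq_iff h2.2.2.2 hv).1 (hM.psi_sub_succ z.1)
    have h4 : succ z.2 = v := hM.succ_eq (sub_ne_zero.1 h2.2.1) h3
    rw [h4]
    exact hPG hv
  pred_mem u hu v hv h := by
    obtain ⟨w, hw⟩ := hd _ h (hM.succ_mem u)
    have h1 : ((succ u, succ v) : Δ × Δ) - (succ u, w) = 0 := by
      by_contra h0
      exact (hm _ (G.sub_mem h (hPG hw)) h0).1 (by simp)
    have h2 : w = succ v := (congrArg Prod.snd (sub_eq_zero.1 h1)).symm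
    rw [h2] at hw
    exact hPG (hP.pred_mem u hu v hv hw)

section Extension

variable (hM : IsModelTlog Δ) {G : Submodule ℚ (Δ × Δ)} (hG : IsPartialIso G)
  {P : Set (Δ × Δ)} (hP : IsPsiIso P) (hGP : psiPart G ⊆ P)
include hM hG hP hGP

/-- Used in contrapositive form: the successor of a point of `P` outside `G` is not in the domain of
`G`, so new points yield new values. -/
theorem mem_of_succ_fst_eq {z w : Δ × Δ} (hz : z ∈ G) (hz1 : z.1 ∈ Psi Δ) (hw : w ∈ P)
    (h : succ w.1 = z.1) : w ∈ G := by
  have h1 : z ∈ P := hGP ⟨hz, hz1, hG.snd_mem_Psi hM hz hz1⟩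
  have h2 := (hP.eq_iff (hP.succ_mem w hw) h1).1 h
  have h3 : (succ w.1, succ w.2) = z := Prod.ext h h2
  exact hG.pred_mem _ (hP.mem w hw).1 _ (hP.mem w hw).2 (h3 ▸ hz)

/-- Induction by adding a new smallest element `a`. Given `b ∈ S`, an element with nonzero
coefficient `q` at `a` is `x + q(a - b)` with `x` in the previous span. The second summand has value
`sa`, which is not a value of the previous span. So the values of the summands differ and the
smaller one decides. The disjunction in the conclusion records the possible values for this purpose.
-/
theorem matched_of_mem_sup_span (S : Finset (Δ × Δ)) :
    (∀ p ∈ S, p ∈ P ∧ p ∉ G) → ∀ z ∈ G ⊔ Submodule.span ℚ (S : Set (Δ × Δ)), z ≠ 0 →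
      Matched P z ∧ ((psi z.1, psi z.2) ∈ G ∨ ∃ p ∈ S, psi z.1 = succ p.1) := by
  classical
  induction S using Finset.induction_on_min_value (Prod.fst : Δ × Δ → Δ) with
  | empty =>
    intro _ z hz h0
    simp only [Finset.coe_empty, Submodule.span_empty, sup_bot_eq] at hz
    obtain ⟨h1, h2, h3, h4⟩ := hG.matched hz h0
    exact ⟨⟨h1, h2, h3, hGP h4⟩, Or.inl h4.1⟩
  | insert a S haS hmin ih =>
    intro hS z hz h0
    have haP := (hS a (Finset.mem_insert_self a S)).1
    have haG := (hS a (Finset.mem_insert_self a S)).2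
    have hSP : ∀ p ∈ S, p ∈ P ∧ p ∉ G := fun p hp => hS p (Finset.mem_insert_of_mem hp)
    replace ih := ih hSP
    obtain ⟨h, hh, q, rfl⟩ : ∃ h ∈ G ⊔ Submodule.span ℚ (S : Set (Δ × Δ)), ∃ q : ℚ,
        z = h + q • a := by
      obtain ⟨g, hg, t, ht, rfl⟩ := Submodule.mem_sup.1 hz
      rw [Finset.coe_insert] at ht
      obtain ⟨q, t', ht', rfl⟩ := Submodule.mem_span_insert.1 ht
      exact ⟨g + t', Submodule.add_mem_sup hg ht', q, by abel⟩
    by_cases hq : q = 0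
    · subst hq
      rw [zero_smul, add_zero] at h0 ⊢
      obtain ⟨h1, h2⟩ := ih h hh h0
      exact ⟨h1, h2.imp_right fun ⟨p, hp, h3⟩ => ⟨p, Finset.mem_insert_of_mem hp, h3⟩⟩
    -- With no other new point available, the element is `q(a - g)` with `g ∈ G`. The successor
    -- identity applies because `sa ≠ sg`, and the value is the smaller of the two.
    rcases S.eq_empty_or_nonempty with rfl | ⟨b, hb⟩
    · simp only [Finset.coe_empty, Submodule.span_empty, sup_bot_eq] at hh
      have hg : -(q⁻¹ • h) ∈ G := G.neg_mem (G.smul_mem _ hh)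
      have hz' : h + q • a = q • (a - -(q⁻¹ • h)) := by
        rw [sub_neg_eq_add, smul_add, smul_smul, mul_inv_cancel₀ hq, one_smul, add_comm]
      generalize -(q⁻¹ • h) = g at hg hz'
      rw [hz']
      have hg1 := hG.succ_mem g hg
      have hg2 : (succ g.1, succ g.2) ∈ P := hGP ⟨hg1, hM.succ_mem _, hM.succ_mem _⟩
      have hne : succ a.1 ≠ succ g.1 := fun h1 =>
        haG (mem_of_succ_fst_eq hM hG hP hGP hg1 (hM.succ_mem _) haP h1)
      rcases hne.lt_or_gt with hlt | hlt
      · obtain ⟨h1, h2⟩ := matched_sub hP hM (hP.succ_mem a haP) hg2 hlt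
          (iff_of_true (hM.sub_succ_neg (hP.mem a haP).1) (hM.sub_succ_neg (hP.mem a haP).2))
        rw [← neg_sub]
        have h3 := h1.neg
        refine ⟨h3.smul hq, Or.inr ⟨a, Finset.mem_insert_self _ _, ?_⟩⟩
        rw [Prod.smul_fst, psi_rat_smul hq h3.1, Prod.fst_neg, psi_neg h1.1, h2]
      · obtain ⟨h1, h2⟩ := matched_sub hP hM hg2 (hP.succ_mem a haP) hlt
          (by simpa using hG.lt_iff (G.sub_mem hg hg1) G.zero_mem)
        refine ⟨h1.smul hq, Or.inl ?_⟩
        have h3 := (hP.eq_iff h1.2.2.2 hg2).1 h2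
        rw [Prod.smul_fst, psi_rat_smul hq h1.1, h2, Prod.smul_snd, psi_rat_smul hq h1.2.1]
        dsimp only at h3
        rw [h3]; exact hg1
    · have hab : a.1 < b.1 := lt_of_le_of_ne (hmin b hb) fun h1 => haS (by
        have h2 : a = b := Prod.ext h1 ((hP.eq_iff haP (hSP b hb).1).1 h1)
        rwa [h2])
      have hz' : h + q • a = (h + q • b) + q • (a - b) := by rw [smul_sub]; abel
      have hh' : h + q • b ∈ G ⊔ Submodule.span ℚ (S : Set (Δ × Δ)) :=
        Submodule.add_mem _ hh (Submodule.smul_mem _ _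
          (Submodule.mem_sup_right (Submodule.subset_span hb)))
      rw [hz']
      generalize h + q • b = x at hh'
      have hw : Matched P (q • (a - b)) ∧ psi (q • (a - b)).1 = succ a.1 := by
        obtain ⟨h1, h2⟩ := matched_sub hP hM (hP.succ_mem a haP) (hP.succ_mem b (hSP b hb).1)
          (hM.succ_lt_succ (hP.mem a haP).1 (hP.mem b (hSP b hb).1).1 hab)
          (iff_of_true (hM.sub_succ_neg (hP.mem a haP).1) (hM.sub_succ_neg (hP.mem a haP).2))
        have h3 := h1.neg
        rw [← neg_sub]
        refine ⟨h3.smul hq, ?_⟩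
        rw [Prod.smul_fst, psi_rat_smul hq h3.1, Prod.fst_neg, psi_neg h1.1, h2]
      by_cases hx0 : x = 0
      · rw [hx0, zero_add]
        exact ⟨hw.1, Or.inr ⟨a, Finset.mem_insert_self _ _, hw.2⟩⟩
      obtain ⟨hx1, hx2⟩ := ih x hh' hx0
      have hne : psi x.1 ≠ succ a.1 := by
        intro h1
        rcases hx2 with hx2 | ⟨p, hp, hx2⟩
        · exact haG (mem_of_succ_fst_eq hM hG hP hGP hx2 (psi_mem_Psi hx1.1) haP h1.symm)
        · have h3 := hM.succ_inj (hP.mem p (hSP p hp).1).1 (hP.mem a haP).1 (hx2.symm.trans h1)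
          have h4 : p = a := Prod.ext h3 ((hP.eq_iff (hSP p hp).1 haP).1 h3)
          exact haS (h4 ▸ hp)
      rcases hne.lt_or_gt with hlt | hlt
      · obtain ⟨h1, h2⟩ := hx1.add hP hM.hType (w := q • (a - b)) fun _ =>
          ⟨hw.1, by rw [hw.2]; exact hlt⟩
        refine ⟨h1, ?_⟩
        have h3 := (hP.eq_iff h1.2.2.2 hx1.2.2.2).1 h2
        dsimp only at h3
        rw [h2, h3]
        exact hx2.imp_right fun ⟨p, hp, h3⟩ => ⟨p, Finset.mem_insert_of_mem hp, h3⟩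
      · obtain ⟨h1, h2⟩ := hw.1.add hP hM.hType (w := x) fun _ =>
          ⟨hx1, by rw [hw.2]; exact hlt⟩
        rw [add_comm x]
        exact ⟨h1, Or.inr ⟨a, Finset.mem_insert_self _ _, h2.trans hw.2⟩⟩

/-- The new domain stays inside `C`, whose whole `Ψ`-part is already in the domain of `P`. Hence no
unmatched element of `Ψ` appears. -/
theorem isPartialIso_sup_span {C : Submodule ℚ Δ} (hC : IsSubcouple C) (hGC : ∀ z ∈ G, z.1 ∈ C)
    (hPC : ∀ z ∈ P, z.1 ∈ C) (hCP : ∀ b ∈ C, b ∈ Psi Δ → ∃ v, (b, v) ∈ P) :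
    IsPartialIso (G ⊔ Submodule.span ℚ P) ∧ ∀ z ∈ G ⊔ Submodule.span ℚ P, z.1 ∈ C := by
  classical
  have hd : ∀ z ∈ G ⊔ Submodule.span ℚ P, z.1 ∈ C := by
    have : G ⊔ Submodule.span ℚ P ≤ C.comap (LinearMap.fst ℚ Δ Δ) :=
      sup_le hGC (Submodule.span_le.2 hPC)
    exact this
  refine ⟨isPartialIso_of_matched hP hM ?_ ?_ ?_ ?_, hd⟩
  · exact fun z hz => Submodule.mem_sup_right (Submodule.subset_span hz)
  · intro z hz h0
    obtain ⟨g, hg, t, ht, rfl⟩ := Submodule.mem_sup.1 hz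
    obtain ⟨T, hT, ht⟩ := Submodule.mem_span_finite_of_mem_span ht
    -- Generators already in `G` are absorbed into `G`, so that only genuinely new ones remain.
    refine (matched_of_mem_sup_span hM hG hP hGP (T.filter fun p => p ∉ G) ?_ _ ?_ h0).1
    · intro p hp
      rw [Finset.mem_filter] at hp
      exact ⟨hT hp.1, hp.2⟩
    · refine Submodule.add_mem _ (Submodule.mem_sup_left hg) ?_
      refine (Submodule.span_le.2 ?_ : Submodule.span ℚ (T : Set (Δ × Δ)) ≤ _) ht
      intro p hp
      by_cases hpG : p ∈ G
      · exact Submodule.mem_sup_left hpG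
      · exact Submodule.mem_sup_right (Submodule.subset_span (by simpa using ⟨hp, hpG⟩))
  · exact fun z hz => hCP _ (hC.succ_mem _ (hd z hz)) (hM.succ_mem _)
  · exact fun z hz h => hCP _ (hd z hz) h

end Extension

end PartialIso

/-! ### Adjoining an element without new values, and back-and-forth -/

section AddElement

variable {Δ : Type*} [AddCommGroup Δ] [LinearOrder Δ] [IsOrderedAddMonoid Δ] [AsymptoticCouple Δ]
  [Module ℚ Δ]

omit [Module ℚ Δ] in
theorem le_psi_sub_trans {x y z γ : Δ} (hxy : x ≠ y) (hyz : y ≠ z) (hxz : x ≠ z)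
    (h1 : γ ≤ psi (x - y)) (h2 : γ ≤ psi (y - z)) : γ ≤ psi (x - z) := by
  have := AsymptoticCouple.ac1 (x - y) (y - z) (sub_ne_zero.2 hxy) (sub_ne_zero.2 hyz)
    (by simpa using sub_ne_zero.2 hxz)
  rw [sub_add_sub_cancel] at this
  exact (le_min h1 h2).trans this

/-- A finite piece of the type of an element over a subspace is realized in the subspace, provided
that the values of the differences are attained in the subspace. -/
theorem exists_mem_approx (hH : IsHType Δ) {K : Submodule ℚ Δ} {a : Δ} (ha : a ∉ K)
    (hK : ∀ k ∈ K, ∃ e ∈ K, e ≠ 0 ∧ psi e = psi (a - k)) (F : Finset Δ) (hFK : ∀ k ∈ F, k ∈ K)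
    (hF : F.Nonempty) :
    ∃ y ∈ K, ∀ k ∈ F, y ≠ k ∧ (k < y ↔ k < a) ∧ psi (y - k) = psi (a - k) := by
  classical
  have hne : ∀ k ∈ F, a ≠ k := fun k hk h => ha (h ▸ hFK k hk)
  -- A best approximation `k₀` to `a` in `F`; its value `γ` is attained by some positive `e ∈ K`,
  -- which serves as a step size.
  obtain ⟨k₀, hk₀, hmax⟩ := F.exists_max_image (fun k => psi (a - k)) hF
  set γ := psi (a - k₀) with hγ
  obtain ⟨e, heK, he0, heγ⟩ : ∃ e ∈ K, 0 < e ∧ psi e = γ := by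
    obtain ⟨e, heK, he0, heγ⟩ := hK k₀ (hFK k₀ hk₀)
    rcases he0.lt_or_gt with h | h
    · exact ⟨-e, K.neg_mem heK, neg_pos.2 h, by rw [psi_neg he0, heγ]⟩
    · exact ⟨e, heK, h, heγ⟩
  have hF0 : ∀ k ∈ F, ∀ l ∈ F, k ≠ l → psi (a - k) = γ → psi (a - l) = γ → γ ≤ psi (k - l) := by
    intro k hk l hl hkl h1 h2
    refine le_psi_sub_trans (hne k hk).symm (hne l hl) hkl ?_ h2.ge
    rw [psi_sub_comm (hne k hk).symm, h1]
  -- Only best approximations matter: for any other `k`, the term `a - k` dominates in `y - k = (a -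
  -- k) + (y - a)`, because `ψ(y - a) ≥ γ`.
  suffices h : ∃ y ∈ K, ∀ k ∈ F, psi (a - k) = γ →
      y ≠ k ∧ (k < y ↔ k < a) ∧ psi (y - k) = γ by
    obtain ⟨y, hyK, hy⟩ := h
    refine ⟨y, hyK, fun k hk => ?_⟩
    by_cases hkγ : psi (a - k) = γ
    · rw [hkγ]; exact hy k hk hkγ
    · have hlt : psi (a - k) < γ := lt_of_le_of_ne (hmax k hk) hkγ
      have hya : y ≠ a := fun h => ha (h ▸ hyK)
      obtain ⟨h1, h2, h3⟩ := hy k₀ hk₀ rfl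
      have h4 : γ ≤ psi (y - a) := le_psi_sub_trans h1 (hne k₀ hk₀).symm hya h3.ge
        (by rw [psi_sub_comm (hne k₀ hk₀).symm])
      obtain ⟨h5, h6⟩ := psi_add_of_lt (x := a - k) (y := y - a) (sub_ne_zero.2 (hne k hk))
        fun _ => hlt.trans_le h4
      have h7 := hH.pos_add_iff (x := a - k) (y := y - a) (sub_ne_zero.2 (hne k hk))
        fun _ => hlt.trans_le h4
      have h8 : a - k + (y - a) = y - k := by abel
      rw [h8] at h5 h6 h7
      exact ⟨sub_ne_zero.1 h5, by rw [← sub_pos, h7, sub_pos], h6⟩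
  have hle : ∀ {y l : Δ}, y ≠ l → psi (y - l) = γ → l ∈ F → psi (a - l) = γ → ∀ k ∈ F,
      psi (a - k) = γ → y ≠ k → γ ≤ psi (y - k) := by
    intro y l hyl hy hl hlγ k hk hkγ hyk
    by_cases hlk : l = k
    · rw [← hlk, hy]
    · exact le_psi_sub_trans hyl hlk hyk hy.ge (hF0 l hl k hk hlk hlγ hkγ)
  have above : ∀ {y l : Δ}, l < y → psi (y - l) = γ → l ∈ F → psi (a - l) = γ → ∀ k ∈ F,
      psi (a - k) = γ → k ≤ l → y ≠ k ∧ k < y ∧ psi (y - k) = γ := by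
    intro y l hly hy hl hlγ k hk hkγ hkl
    have hky := hkl.trans_lt hly
    refine ⟨hky.ne', hky, le_antisymm ?_ (hle hly.ne' hy hl hlγ k hk hkγ hky.ne')⟩
    rw [← hy]
    exact hH _ _ (sub_pos.2 hly) (sub_le_sub_left hkl y)
  have below : ∀ {y r : Δ}, y < r → psi (y - r) = γ → r ∈ F → psi (a - r) = γ → ∀ k ∈ F,
      psi (a - k) = γ → r ≤ k → y ≠ k ∧ y < k ∧ psi (y - k) = γ := by
    intro y r hyr hy hr hrγ k hk hkγ hrk
    have hyk := hyr.trans_le hrk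
    refine ⟨hyk.ne, hyk, le_antisymm ?_ (hle hyr.ne hy hr hrγ k hk hkγ hyk.ne)⟩
    rw [← hy, psi_sub_comm hyk.ne, psi_sub_comm hyr.ne]
    exact hH _ _ (sub_pos.2 hyr) (sub_le_sub_right hrk y)
  -- The best approximations on either side of `a`. If one side is empty, `y` is one step `e` beyond
  -- the extreme point of the other side; otherwise `y` is the midpoint of the two nearest points.
  let L := F.filter fun k => psi (a - k) = γ ∧ k < a
  let R := F.filter fun k => psi (a - k) = γ ∧ a < k
  rcases L.eq_empty_or_nonempty with hL | hL
  · have hk₀R : k₀ ∈ R := by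
      refine Finset.mem_filter.2 ⟨hk₀, rfl, (hne k₀ hk₀).lt_or_gt.resolve_right fun h => ?_⟩
      have : k₀ ∈ L := Finset.mem_filter.2 ⟨hk₀, rfl, h⟩
      simp [hL] at this
    obtain ⟨r, hr, hrmin⟩ := R.exists_min_image id ⟨k₀, hk₀R⟩
    obtain ⟨hrF, hrγ, hra⟩ := Finset.mem_filter.1 hr
    refine ⟨r - e, K.sub_mem (hFK r hrF) heK, fun k hk hkγ => ?_⟩
    have hak : a < k := (hne k hk).lt_or_gt.resolve_right fun h => by
      have : k ∈ L := Finset.mem_filter.2 ⟨hk, hkγ, h⟩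
      simp [hL] at this
    obtain ⟨h1, h2, h3⟩ := below (y := r - e) (sub_lt_self r he0)
      (by rw [sub_sub_cancel_left, psi_neg he0.ne', heγ]) hrF hrγ k hk hkγ
      (hrmin k (Finset.mem_filter.2 ⟨hk, hkγ, hak⟩))
    exact ⟨h1, iff_of_false h2.not_gt hak.not_gt, h3⟩
  · obtain ⟨l, hl, hlmax⟩ := L.exists_max_image id hL
    obtain ⟨hlF, hlγ, hla⟩ := Finset.mem_filter.1 hl
    rcases R.eq_empty_or_nonempty with hR | hR
    · refine ⟨l + e, K.add_mem (hFK l hlF) heK, fun k hk hkγ => ?_⟩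
      have hak : k < a := (hne k hk).lt_or_gt.resolve_left fun h => by
        have : k ∈ R := Finset.mem_filter.2 ⟨hk, hkγ, h⟩
        simp [hR] at this
      obtain ⟨h1, h2, h3⟩ := above (y := l + e) (lt_add_of_pos_right l he0)
        (by rw [add_sub_cancel_left, heγ]) hlF hlγ k hk hkγ
        (hlmax k (Finset.mem_filter.2 ⟨hk, hkγ, hak⟩))
      exact ⟨h1, iff_of_true h2 hak, h3⟩
    · obtain ⟨r, hr, hrmin⟩ := R.exists_min_image id hR
      obtain ⟨hrF, hrγ, hra⟩ := Finset.mem_filter.1 hr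
      have hlr : 0 < r - l := sub_pos.2 (hla.trans hra)
      have hψ : psi (r - l) = γ := by
        refine le_antisymm ?_ (hF0 r hrF l hlF (hla.trans hra).ne' hrγ hlγ)
        rw [← hlγ]
        exact hH _ _ (sub_pos.2 hla) (sub_le_sub_right hra.le l)
      have hhalf : (2⁻¹ : ℚ) • (r - l) + (2⁻¹ : ℚ) • (r - l) = r - l := by
        rw [← add_smul]; norm_num
      have hd0 : 0 < (2⁻¹ : ℚ) • (r - l) := rat_smul_pos (by norm_num) hlr
      have hdγ : psi ((2⁻¹ : ℚ) • (r - l)) = γ := by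
        rw [psi_rat_smul (by norm_num) hlr.ne', hψ]
      have hdK : (2⁻¹ : ℚ) • (r - l) ∈ K := K.smul_mem _ (K.sub_mem (hFK r hrF) (hFK l hlF))
      generalize (2⁻¹ : ℚ) • (r - l) = d at *
      have hr' : r = l + d + d := by rw [add_assoc, hhalf]; abel
      refine ⟨l + d, K.add_mem (hFK l hlF) hdK, fun k hk hkγ => ?_⟩
      rcases (hne k hk).lt_or_gt with hak | hak
      · obtain ⟨h1, h2, h3⟩ := below (y := l + d) (r := r)
          (by rw [hr']; exact lt_add_of_pos_right _ hd0)
          (by rw [hr', sub_add_cancel_left, psi_neg hd0.ne', hdγ]) hrF hrγ k hk hkγ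
          (hrmin k (Finset.mem_filter.2 ⟨hk, hkγ, hak⟩))
        exact ⟨h1, iff_of_false h2.not_gt hak.not_gt, h3⟩
      · obtain ⟨h1, h2, h3⟩ := above (y := l + d) (lt_add_of_pos_right l hd0)
          (by rw [add_sub_cancel_left, hdγ]) hlF hlγ k hk hkγ
          (hlmax k (Finset.mem_filter.2 ⟨hk, hkγ, hak⟩))
        exact ⟨h1, iff_of_true h2 hak, h3⟩

variable (hM : IsModelTlog Δ) (hS : IsCountablySaturated Δ) {G : Submodule ℚ (Δ × Δ)}
  (hG : IsPartialIso G)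
include hM hS hG

/-- By `hCG`, every value `ψ(a - g)` already has an image, so the cut and values of `a` over the
domain translate into countably many conditions on `a'`. Finitely many of them are met by the image
of an approximation to `a` inside the domain. -/
theorem IsPartialIso.exists_add_element {C : Submodule ℚ Δ} (hC : IsSubcouple C)
    (hcount : (C : Set Δ).Countable) (hGC : ∀ z ∈ G, z.1 ∈ C)
    (hCG : ∀ b ∈ C, b ∈ Psi Δ → ∃ v, (b, v) ∈ G) {a : Δ} (haC : a ∈ C) :
    ∃ a', IsPartialIso (G ⊔ Submodule.span ℚ {(a, a')}) := by
  classical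
  by_cases haG : ∃ z ∈ G, z.1 = a
  · obtain ⟨z, hz, rfl⟩ := haG
    refine ⟨z.2, ?_⟩
    rwa [sup_eq_left.2 (Submodule.span_le.2 (Set.singleton_subset_iff.2 hz))]
  push Not at haG
  have hval : ∀ z ∈ G, ∃ v, (psi (a - z.1), v) ∈ G := fun z hz =>
    hCG _ (hC.psi_mem _ (C.sub_mem haC (hGC z hz)) (sub_ne_zero.2 (haG z hz).symm))
      (psi_mem_Psi (sub_ne_zero.2 (haG z hz).symm))
  obtain ⟨f, hf⟩ := (hG.countable hcount hGC).exists_eq_range ⟨0, G.zero_mem⟩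
  have hfG : ∀ n, f n ∈ G := fun n => by
    have : f n ∈ (G : Set (Δ × Δ)) := hf ▸ ⟨n, rfl⟩
    exact this
  choose γ hγ using fun n => hval (f n) (hfG n)
  obtain ⟨a', ha'⟩ := hS.exists_psi_sub (fun n => (f n).2) γ (fun n => (f n).1 < a) (fun N => by
    let K := G.map (LinearMap.fst ℚ Δ Δ)
    have haK : a ∉ K := by
      rintro ⟨z, hz, rfl⟩
      exact haG z hz rfl
    obtain ⟨y, hyK, hy⟩ := exists_mem_approx hM.hType haK (by
      rintro _ ⟨z, hz, rfl⟩
      obtain ⟨v, hv⟩ := hval z hz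
      obtain ⟨w, hw, h1, h2⟩ := hG.exists_psi_eq hM hv
        (psi_mem_Psi (sub_ne_zero.2 (haG z hz).symm))
      exact ⟨w.1, ⟨w, hw, rfl⟩, h1, h2⟩)
      ((Finset.range (N + 1)).image fun n => (f n).1)
      (by
        intro k hk
        obtain ⟨n, -, rfl⟩ := Finset.mem_image.1 hk
        exact ⟨f n, hfG n, rfl⟩)
      (by simp)
    obtain ⟨w, hw, rfl⟩ := hyK
    refine ⟨w.2, fun n hn => ?_⟩
    obtain ⟨h1, h2, h3⟩ := hy (f n).1
      (Finset.mem_image_of_mem (fun n => (f n).1) (Finset.mem_range.2 (by omega)))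
    refine ⟨fun h => h1 ((hG.eq_iff hw (hfG n)).2 h), ?_, ?_⟩
    · rw [← hG.lt_iff (hfG n) hw]; exact h2
    · have h4 := hG.psi_mem (w - f n) (G.sub_mem hw (hfG n)) (sub_ne_zero.2 h1)
      exact (hG.eq_iff h4 (hγ n)).1 h3)
  have hmatch : ∀ z ∈ G, Matched (psiPart G) ((a, a') - z) := by
    intro z hz
    have : z ∈ (G : Set (Δ × Δ)) := hz
    rw [hf] at this
    obtain ⟨n, rfl⟩ := this
    obtain ⟨h1, h2, h3⟩ := ha' n
    have h4 : a - (f n).1 ≠ 0 := sub_ne_zero.2 (haG _ hz).symm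
    refine ⟨h4, sub_ne_zero.2 h1, ?_, ?_, psi_mem_Psi h4, psi_mem_Psi (sub_ne_zero.2 h1)⟩
    · simp only [Prod.fst_sub, Prod.snd_sub, sub_pos]; exact h2.symm
    · simp only [Prod.fst_sub, Prod.snd_sub, h3]; exact hγ n
  have hd : ∀ z ∈ G ⊔ Submodule.span ℚ {(a, a')}, z.1 ∈ C := by
    have : G ⊔ Submodule.span ℚ {(a, a')} ≤ C.comap (LinearMap.fst ℚ Δ Δ) :=
      sup_le hGC (Submodule.span_le.2 (by simpa using haC))
    exact this
  have hCP : ∀ b ∈ C, b ∈ Psi Δ → ∃ v, (b, v) ∈ psiPart G := fun b hb hbΨ => by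
    obtain ⟨v, hv⟩ := hCG b hb hbΨ
    exact ⟨v, hv, hbΨ, hG.snd_mem_Psi hM hv hbΨ⟩
  refine ⟨a', isPartialIso_of_matched (hG.isPsiIso hM) hM
    (fun z hz => Submodule.mem_sup_left hz.1) ?_
    (fun z hz => hCP _ (hC.succ_mem _ (hd z hz)) (hM.succ_mem _))
    (fun z hz h => hCP _ (hd z hz) h)⟩
  intro z hz h0
  obtain ⟨g, hg, t, ht, rfl⟩ := Submodule.mem_sup.1 hz
  obtain ⟨q, rfl⟩ := Submodule.mem_span_singleton.1 ht
  by_cases hq : q = 0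
  · simp only [hq, zero_smul, add_zero] at h0 ⊢
    exact hG.matched hg h0
  -- For `q ≠ 0`, the element is `q` times the difference of `(a, a')` and the element `-q⁻¹g` of
  -- `G`.
  · have h1 := (hmatch _ (G.neg_mem (G.smul_mem q⁻¹ hg))).smul hq
    rwa [sub_neg_eq_add, smul_add, smul_smul, mul_inv_cancel₀ hq, one_smul, add_comm] at h1

/-- The back-and-forth property. -/
theorem IsPartialIso.exists_extension (hc : (G : Set (Δ × Δ)).Countable) {P : Set (Δ × Δ)}
    (hP : IsPsiIso P) (hPc : P.Countable) (hGP : psiPart G ⊆ P) (a : Δ) :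
    ∃ G' : Submodule ℚ (Δ × Δ), IsPartialIso G' ∧ (G' : Set (Δ × Δ)).Countable ∧ G ≤ G' ∧
      P ⊆ G' ∧ ∃ a', (a, a') ∈ G' := by
  -- Including `a` in `C` beforehand ensures that all values it can produce over the domain are
  -- matched before `a` is adjoined.
  obtain ⟨C, hC, hCc, hBC⟩ := hM.exists_countable_subcouple
    (B := (Prod.fst '' (G : Set (Δ × Δ))) ∪ (Prod.fst '' P) ∪ {a})
    (((hc.image _).union (hPc.image _)).union (Set.countable_singleton a))
  have hGC : ∀ z ∈ G, z.1 ∈ C := fun z hz => hBC (Or.inl (Or.inl ⟨z, hz, rfl⟩))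
  have hPC : ∀ z ∈ P, z.1 ∈ C := fun z hz => hBC (Or.inl (Or.inr ⟨z, hz, rfl⟩))
  have haC : a ∈ C := hBC (Or.inr rfl)
  obtain ⟨P', hPP', hP', hP'C, hCP'⟩ := hP.exists_extension hM hS hCc hC.succ_mem hC.pred_mem hPC
  obtain ⟨hG₁, hG₁C⟩ := isPartialIso_sup_span hM hG hP' (hGP.trans hPP') hC hGC hP'C hCP'
  have hP'G : P' ⊆ (G ⊔ Submodule.span ℚ P' : Submodule ℚ (Δ × Δ)) := fun z hz =>
    Submodule.mem_sup_right (Submodule.subset_span hz)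
  obtain ⟨a', hG₂⟩ := hG₁.exists_add_element hM hS hC hCc hG₁C
    (fun b hb hbΨ => (hCP' b hb hbΨ).imp fun v hv => hP'G hv) haC
  refine ⟨_, hG₂, hG₂.countable hCc ?_, le_sup_left.trans le_sup_left,
    fun z hz => Submodule.mem_sup_left (hP'G (hPP' hz)), a',
    Submodule.mem_sup_right (Submodule.mem_span_singleton_self _)⟩
  have : (G ⊔ Submodule.span ℚ P') ⊔ Submodule.span ℚ {(a, a')} ≤
      C.comap (LinearMap.fst ℚ Δ Δ) :=
    sup_le hG₁C (Submodule.span_le.2 (by simpa using haC))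
  exact this

theorem IsPartialIso.exists_fst (hc : (G : Set (Δ × Δ)).Countable) (a : Δ) :
    ∃ G' : Submodule ℚ (Δ × Δ), IsPartialIso G' ∧ (G' : Set (Δ × Δ)).Countable ∧ G ≤ G' ∧
      ∃ a', (a, a') ∈ G' := by
  obtain ⟨G', h1, h2, h3, -, h4⟩ := hG.exists_extension hM hS hc (hG.isPsiIso hM)
    (hc.mono fun z hz => hz.1) subset_rfl a
  exact ⟨G', h1, h2, h3, h4⟩

theorem IsPartialIso.exists_snd (hc : (G : Set (Δ × Δ)).Countable) (a : Δ) :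
    ∃ G' : Submodule ℚ (Δ × Δ), IsPartialIso G' ∧ (G' : Set (Δ × Δ)).Countable ∧ G ≤ G' ∧
      ∃ a', (a', a) ∈ G' := by
  have hsw : ∀ {H : Submodule ℚ (Δ × Δ)}, (H : Set (Δ × Δ)).Countable →
      (H.comap (LinearEquiv.prodComm ℚ Δ Δ).toLinearMap : Set (Δ × Δ)).Countable := fun h =>
    h.preimage Prod.swap_injective
  obtain ⟨G', h1, h2, h3, a', h4⟩ := hG.swap.exists_fst hM hS (hsw hc) a
  exact ⟨_, h1.swap, hsw h2, fun z hz => h3 (show z.swap ∈ _ from by simpa using hz), a', h4⟩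

/-- Elements of `Ψ` that realize the same cut correspond under a partial automorphism. -/
theorem IsPartialIso.exists_mem_of_cutMatch (hc : (G : Set (Δ × Δ)).Countable) {b b' : Δ}
    (hb : b ∈ Psi Δ) (hb' : b' ∈ Psi Δ) (h : CutMatch (psiPart G) b b') :
    ∃ G' : Submodule ℚ (Δ × Δ), IsPartialIso G' ∧ (G' : Set (Δ × Δ)).Countable ∧ G ≤ G' ∧
      (b, b') ∈ G' := by
  have hP := (hG.isPsiIso hM).union_orbit hM hb hb' h
  have horb : (orbit b b').Countable := by
    refine Set.Countable.mono (s₂ := ⋃ m : ℕ, ⋃ n : ℕ,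
      {z : Δ × Δ | z.1 ∈ Psi Δ ∧ z.2 ∈ Psi Δ ∧ succ^[m] z.1 = succ^[n] b ∧
        succ^[m] z.2 = succ^[n] b'}) ?_ ?_
    · rintro z ⟨h1, h2, m, n, h3, h4⟩
      exact Set.mem_iUnion₂.2 ⟨m, n, h1, h2, h3, h4⟩
    · refine Set.countable_iUnion fun m => Set.countable_iUnion fun n =>
        Set.Subsingleton.countable ?_
      rintro z ⟨h1, h2, h3, h4⟩ w ⟨h1', h2', h3', h4'⟩
      have hinj : ∀ {u v : Δ}, u ∈ Psi Δ → v ∈ Psi Δ → succ^[m] u = succ^[m] v → u = v := by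
        intro u v hu hv huv
        have h5 := hM.iterate_succ_lt_iff hu hv m
        have h6 := hM.iterate_succ_lt_iff hv hu m
        rw [huv] at h5 h6
        simp only [lt_self_iff_false, false_iff, not_lt] at h5 h6
        exact le_antisymm h6 h5
      exact Prod.ext (hinj h1 h1' (h3.trans h3'.symm)) (hinj h2 h2' (h4.trans h4'.symm))
  -- Only the prescribed part on `Ψ` is needed here; the element `0` is a dummy.
  obtain ⟨G', h1, h2, h3, h4, -⟩ := hG.exists_extension hM hS hc hP
    ((hc.mono fun z hz => hz.1).union horb) Set.subset_union_left 0
  exact ⟨G', h1, h2, h3, h4 (Or.inr (mem_orbit_self hb hb'))⟩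

end AddElement

/-! ### The ultrapower as a saturated model -/

section Ultrapower

open Filter

variable (Γ : Type*)

/-- The ultrapower of `Γ` modulo a nonprincipal ultrafilter on `ℕ`. -/
abbrev Ultrapower : Type _ := Germ (hyperfilter ℕ : Filter ℕ) Γ

variable {Γ}

theorem Ultrapower.coe_eq_iff {f g : ℕ → Γ} :
    (f : Ultrapower Γ) = g ↔ ∀ᶠ n in (hyperfilter ℕ : Filter ℕ), f n = g n := Germ.coe_eq

theorem Ultrapower.coe_ne_iff {f g : ℕ → Γ} :
    (f : Ultrapower Γ) ≠ g ↔ ∀ᶠ n in (hyperfilter ℕ : Filter ℕ), f n ≠ g n := by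
  rw [Ne, Ultrapower.coe_eq_iff, ← Ultrafilter.eventually_not]

theorem Ultrapower.exists_coe (x : Ultrapower Γ) : ∃ f : ℕ → Γ, (f : Ultrapower Γ) = x :=
  Quot.exists_rep x

/-- Diagonalization in an ultrapower: a sequence of internal sets with the finite intersection
property has a common point. -/
theorem exists_forall_eventually_mem {T : ℕ → ℕ → Set Γ}
    (h : ∀ k, ∀ᶠ n in (hyperfilter ℕ : Filter ℕ), ∃ x, ∀ j ≤ k, x ∈ T j n) :
    ∃ f : ℕ → Γ, ∀ k, ∀ᶠ n in (hyperfilter ℕ : Filter ℕ), f n ∈ T k n := by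
  classical
  have hne : Nonempty Γ := by
    obtain ⟨n, x, -⟩ := (h 0).exists
    exact ⟨x⟩
  have hx : ∀ n, ∃ x, ∀ k ≤ n, (∃ y, ∀ j ≤ k, y ∈ T j n) → x ∈ T k n := by
    intro n
    by_cases h0 : ∃ k ≤ n, ∃ y, ∀ j ≤ k, y ∈ T j n
    · let m := Nat.findGreatest (fun k => ∃ y, ∀ j ≤ k, y ∈ T j n) n
      obtain ⟨k, hk, hy⟩ := h0
      obtain ⟨y, hy⟩ : ∃ y, ∀ j ≤ m, y ∈ T j n :=
        Nat.findGreatest_spec (P := fun k => ∃ y, ∀ j ≤ k, y ∈ T j n) hk hy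
      exact ⟨y, fun k hk hky => hy k (Nat.le_findGreatest hk hky)⟩
    · push Not at h0
      exact ⟨Classical.arbitrary Γ, fun k hk ⟨y, hy⟩ => by
        obtain ⟨j, hj, h1⟩ := h0 k hk y
        exact absurd (hy j hj) h1⟩
  choose f hf using hx
  refine ⟨f, fun k => ?_⟩
  have hk : ∀ᶠ n in (hyperfilter ℕ : Filter ℕ), k ≤ n := by
    have h1 : ∀ᶠ n in cofinite, k ≤ n := Nat.cofinite_eq_atTop ▸ eventually_ge_atTop k
    exact h1.filter_mono hyperfilter_le_cofinite
  filter_upwards [h k, hk] with n h1 h2 using hf n k h2 h1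

variable [AddCommGroup Γ] [LinearOrder Γ] [IsOrderedAddMonoid Γ] [AsymptoticCouple Γ]

omit [LinearOrder Γ] [IsOrderedAddMonoid Γ] [AsymptoticCouple Γ] in
theorem Ultrapower.coe_ne_zero_iff {f : ℕ → Γ} :
    (f : Ultrapower Γ) ≠ 0 ↔ ∀ᶠ n in (hyperfilter ℕ : Filter ℕ), f n ≠ 0 :=
  Ultrapower.coe_ne_iff (g := 0)

omit [AddCommGroup Γ] [IsOrderedAddMonoid Γ] [AsymptoticCouple Γ] in
theorem Ultrapower.coe_lt_iff_prop {f g : ℕ → Γ} {t : Prop} :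
    ((f : Ultrapower Γ) < g ↔ t) ↔ ∀ᶠ n in (hyperfilter ℕ : Filter ℕ), (f n < g n ↔ t) := by
  by_cases h : t
  · simp only [h, iff_true]; exact Germ.coe_lt
  · simp only [h, iff_false]
    rw [Ultrafilter.eventually_not]
    exact not_congr Germ.coe_lt

instance : AsymptoticCouple (Ultrapower Γ) where
  psi := Germ.map psi
  ac1 α β := Germ.inductionOn₂ α β fun f g hf hg hfg => by
    rw [Ultrapower.coe_ne_zero_iff] at hf hg
    rw [← Germ.coe_add, Ultrapower.coe_ne_zero_iff] at hfg
    rw [Germ.min_def]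
    change ((fun n => min (psi (f n)) (psi (g n)) : ℕ → Γ) : Ultrapower Γ) ≤
      ((fun n => psi ((f + g) n) : ℕ → Γ) : Ultrapower Γ)
    refine Germ.coe_le.2 ?_
    filter_upwards [hf, hg, hfg] with n h1 h2 h3 using AsymptoticCouple.ac1 _ _ h1 h2 h3
  ac2 α := Germ.inductionOn α fun f hf r hr => by
    rw [Ultrapower.coe_ne_zero_iff] at hf
    refine Ultrapower.coe_eq_iff.2 ?_
    filter_upwards [hf] with n h1 using AsymptoticCouple.ac2 _ h1 r hr
  ac3 α β := Germ.inductionOn₂ α β fun f g hf hg hf0 => by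
    rw [Ultrapower.coe_ne_zero_iff] at hf hg
    rw [Germ.coe_pos] at hf0
    refine Germ.coe_lt.2 ?_
    filter_upwards [hf, hg, hf0] with n h1 h2 h3 using AsymptoticCouple.ac3 _ _ h1 h2 h3

theorem Ultrapower.psi_coe (f : ℕ → Γ) :
    psi (f : Ultrapower Γ) = ((fun n => psi (f n) : ℕ → Γ) : Ultrapower Γ) := rfl

theorem Ultrapower.coe_mem_Psi {f : ℕ → Γ} :
    (f : Ultrapower Γ) ∈ Psi (Ultrapower Γ) ↔
      ∀ᶠ n in (hyperfilter ℕ : Filter ℕ), f n ∈ Psi Γ := by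
  constructor
  · rintro ⟨g, hg, h⟩
    obtain ⟨g, rfl⟩ := Ultrapower.exists_coe g
    have hg := Ultrapower.coe_ne_zero_iff.1 hg
    have h := Ultrapower.coe_eq_iff.1 h
    filter_upwards [hg, h] with n h1 h2 using ⟨g n, h1, h2⟩
  · intro h
    obtain ⟨g, hg⟩ := Eventually.choice (r := fun n x => x ≠ 0 ∧ psi x = f n)
      (h.mono fun n hn => hn)
    exact ⟨(g : Ultrapower Γ), Ultrapower.coe_ne_zero_iff.2 (hg.mono fun n hn => hn.1),
      Ultrapower.coe_eq_iff.2 (hg.mono fun n hn => hn.2)⟩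

variable (hM : IsModelTlog Γ)
include hM

theorem IsModelTlog.isHType_ultrapower : IsHType (Ultrapower Γ) := fun α β =>
  Germ.inductionOn₂ α β fun f g hf h => by
    rw [Germ.coe_pos] at hf
    have h := Germ.coe_le.1 h
    refine Germ.coe_le.2 ?_
    filter_upwards [hf, h] with n h1 h2 using hM.hType _ _ h1 h2

theorem IsModelTlog.coe_integral (f : ℕ → Γ) :
    ((fun n => integral (f n) : ℕ → Γ) : Ultrapower Γ) ≠ 0 ∧
      ((fun n => integral (f n) : ℕ → Γ) : Ultrapower Γ) +
        psi ((fun n => integral (f n) : ℕ → Γ) : Ultrapower Γ) = f := by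
  refine ⟨Ultrapower.coe_ne_zero_iff.2 (Eventually.of_forall fun n =>
    (integral_spec hM.asymptoticIntegration (f n)).1), ?_⟩
  rw [Ultrapower.psi_coe, ← Germ.coe_add]
  exact Ultrapower.coe_eq_iff.2 (Eventually.of_forall fun n =>
    (integral_spec hM.asymptoticIntegration (f n)).2)

theorem IsModelTlog.hasAsymptoticIntegration_ultrapower :
    HasAsymptoticIntegration (Ultrapower Γ) := fun α =>
  Germ.inductionOn α fun f => ⟨_, hM.coe_integral f⟩

/-- The pointwise integrals represent an integral of the germ, and integrals in the ultrapower are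
unique. -/
theorem IsModelTlog.succ_coe (f : ℕ → Γ) :
    succ (f : Ultrapower Γ) = ((fun n => succ (f n) : ℕ → Γ) : Ultrapower Γ) := by
  rw [succ, integral_unique hM.isHType_ultrapower hM.hasAsymptoticIntegration_ultrapower
    (hM.coe_integral f).1 (hM.coe_integral f).2]
  rfl

theorem IsModelTlog.succ_zero_ultrapower :
    succ (0 : Ultrapower Γ) = ((fun _ => succ 0 : ℕ → Γ) : Ultrapower Γ) := hM.succ_coe 0

theorem IsModelTlog.ultrapower : IsModelTlog (Ultrapower Γ) where
  divisible n hn α := Germ.inductionOn α fun f => by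
    choose g hg using fun i => hM.divisible n hn (f i)
    exact ⟨(g : Ultrapower Γ), Ultrapower.coe_eq_iff.2 (Eventually.of_forall hg)⟩
  hType := hM.isHType_ultrapower
  asymptoticIntegration := hM.hasAsymptoticIntegration_ultrapower
  isLeast := by
    rw [hM.succ_zero_ultrapower]
    refine ⟨Ultrapower.coe_mem_Psi.2 (Eventually.of_forall fun _ => hM.isLeast.1), fun α => ?_⟩
    refine Germ.inductionOn α fun f hf => ?_
    rw [Ultrapower.coe_mem_Psi] at hf
    exact Germ.coe_le.2 (hf.mono fun n hn => hM.isLeast.2 hn)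
  succ_zero_pos := by
    rw [hM.succ_zero_ultrapower]
    exact Germ.coe_pos.2 (Eventually.of_forall fun _ => hM.succ_zero_pos)
  succ_spec α := Germ.inductionOn α fun f hf => by
    rw [Ultrapower.coe_mem_Psi] at hf
    rw [hM.succ_coe]
    refine ⟨Ultrapower.coe_mem_Psi.2 (hf.mono fun n hn => (hM.succ_spec _ hn).1),
      Germ.coe_lt.2 (hf.mono fun n hn => (hM.succ_spec _ hn).2.1), fun β => ?_⟩
    refine Germ.inductionOn β fun g hg hfg => ?_
    rw [Ultrapower.coe_mem_Psi] at hg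
    have hfg := Germ.coe_lt.1 hfg
    refine Germ.coe_le.2 ?_
    filter_upwards [hf, hg, hfg] with n h1 h2 h3 using (hM.succ_spec _ h1).2.2 _ h2 h3
  succ_bij := by
    rw [hM.succ_zero_ultrapower]
    refine ⟨fun α => ?_, fun α => ?_, fun α => ?_⟩
    · refine Germ.inductionOn α fun f hf => ?_
      rw [Ultrapower.coe_mem_Psi] at hf
      rw [hM.succ_coe]
      exact ⟨Ultrapower.coe_mem_Psi.2 (hf.mono fun n hn => (hM.succ_bij.mapsTo hn).1),
        Germ.coe_lt.2 (hf.mono fun n hn => (hM.succ_bij.mapsTo hn).2)⟩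
    · refine Germ.inductionOn α fun f hf β => Germ.inductionOn β fun g hg h => ?_
      rw [Ultrapower.coe_mem_Psi] at hf hg
      rw [hM.succ_coe, hM.succ_coe] at h
      have h := Ultrapower.coe_eq_iff.1 h
      refine Ultrapower.coe_eq_iff.2 ?_
      filter_upwards [hf, hg, h] with n h1 h2 h3 using hM.succ_inj h1 h2 h3
    · refine Germ.inductionOn α fun f hf => ?_
      obtain ⟨h1, h2⟩ := hf
      rw [Ultrapower.coe_mem_Psi] at h1
      have h2 := Germ.coe_lt.1 h2
      obtain ⟨g, hg⟩ := Eventually.choice (r := fun n x => x ∈ Psi Γ ∧ succ x = f n)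
        (by filter_upwards [h1, h2] with n h1 h2 using hM.succ_bij.surjOn ⟨h1, h2⟩)
      refine ⟨(g : Ultrapower Γ), Ultrapower.coe_mem_Psi.2 (hg.mono fun n hn => hn.1), ?_⟩
      rw [hM.succ_coe]
      exact Ultrapower.coe_eq_iff.2 (hg.mono fun n hn => hn.2)

omit hM in
-- Finite satisfiability in the ultrapower yields, for almost every index, satisfiability in `Γ`.
-- Diagonalization then provides a common solution.
theorem isCountablySaturated_ultrapower : IsCountablySaturated (Ultrapower Γ) where
  exists_mem_Psi e t h := by
    choose E hE using fun n => Ultrapower.exists_coe (e n)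
    obtain ⟨f, hf⟩ := exists_forall_eventually_mem
      (T := fun n i => {x | x ∈ Psi Γ ∧ x ≠ E n i ∧ (E n i < x ↔ t n)}) fun k => by
        obtain ⟨x, hx, h1⟩ := h k
        obtain ⟨f, rfl⟩ := Ultrapower.exists_coe x
        have h2 : ∀ᶠ i in (hyperfilter ℕ : Filter ℕ), ∀ j ∈ Set.Iic k,
            f i ≠ E j i ∧ (E j i < f i ↔ t j) :=
          (eventually_all_finite (Set.finite_Iic k)).2 fun j hj => by
            obtain ⟨h3, h4⟩ := h1 j hj
            rw [← hE] at h3 h4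
            exact (Ultrapower.coe_ne_iff.1 h3).and (Ultrapower.coe_lt_iff_prop.1 h4)
        filter_upwards [h2, Ultrapower.coe_mem_Psi.1 hx] with i h3 h4
        exact ⟨f i, fun j hj => ⟨h4, h3 j hj⟩⟩
    refine ⟨(f : Ultrapower Γ), Ultrapower.coe_mem_Psi.2 ((hf 0).mono fun i hi => hi.1),
      fun n => ?_⟩
    rw [← hE]
    exact ⟨Ultrapower.coe_ne_iff.2 ((hf n).mono fun i hi => hi.2.1),
      Ultrapower.coe_lt_iff_prop.2 ((hf n).mono fun i hi => hi.2.2)⟩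
  exists_psi_sub e γ t h := by
    choose E hE using fun n => Ultrapower.exists_coe (e n)
    choose c hc using fun n => Ultrapower.exists_coe (γ n)
    obtain ⟨f, hf⟩ := exists_forall_eventually_mem
      (T := fun n i => {x | x ≠ E n i ∧ (E n i < x ↔ t n) ∧ psi (x - E n i) = c n i}) fun k => by
        obtain ⟨x, h1⟩ := h k
        obtain ⟨f, rfl⟩ := Ultrapower.exists_coe x
        have h2 : ∀ᶠ i in (hyperfilter ℕ : Filter ℕ), ∀ j ∈ Set.Iic k,
            f i ≠ E j i ∧ (E j i < f i ↔ t j) ∧ psi (f i - E j i) = c j i :=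
          (eventually_all_finite (Set.finite_Iic k)).2 fun j hj => by
            obtain ⟨h3, h4, h5⟩ := h1 j hj
            rw [← hE] at h3 h4 h5
            rw [← hc] at h5
            exact (Ultrapower.coe_ne_iff.1 h3).and ((Ultrapower.coe_lt_iff_prop.1 h4).and
              (Ultrapower.coe_eq_iff.1 h5))
        exact h2.mono fun i h3 => ⟨f i, h3⟩
    refine ⟨(f : Ultrapower Γ), fun n => ?_⟩
    rw [← hE, ← hc]
    exact ⟨Ultrapower.coe_ne_iff.2 ((hf n).mono fun i hi => hi.1),
      Ultrapower.coe_lt_iff_prop.2 ((hf n).mono fun i hi => hi.2.1),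
      Ultrapower.coe_eq_iff.2 ((hf n).mono fun i hi => hi.2.2)⟩

end Ultrapower

/-! ### Formulas along the ultrafilter -/

section Corresp

open Filter

variable {Γ : Type*} [AddCommGroup Γ] [LinearOrder Γ] [IsOrderedAddMonoid Γ] [AsymptoticCouple Γ]
  [Module ℚ Γ]

/-- Two sequences in `Γ_∞` whose germs are both `∞` or correspond to each other under `G`. -/
def Corresp (G : Submodule ℚ (Ultrapower Γ × Ultrapower Γ)) (f g : ℕ → WithTop Γ) : Prop :=
  (∀ᶠ n in (hyperfilter ℕ : Filter ℕ), f n = ⊤ ∧ g n = ⊤) ∨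
  ∃ a b : ℕ → Γ, (∀ᶠ n in (hyperfilter ℕ : Filter ℕ), f n = a n ∧ g n = b n) ∧
    ((a : Ultrapower Γ), (b : Ultrapower Γ)) ∈ G

omit [LinearOrder Γ] [IsOrderedAddMonoid Γ] [AsymptoticCouple Γ] [Module ℚ Γ] [AddCommGroup Γ] in
theorem eventually_eq_top_or_coe (f : ℕ → WithTop Γ) :
    (∀ᶠ n in (hyperfilter ℕ : Filter ℕ), f n = ⊤) ∨
      ∃ a : ℕ → Γ, ∀ᶠ n in (hyperfilter ℕ : Filter ℕ), f n = a n := by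
  rcases Ultrafilter.em (hyperfilter ℕ) (fun n => f n = ⊤) with h | h
  · exact Or.inl h
  · by_cases hΓ : Nonempty Γ
    · exact Or.inr (Eventually.choice (r := fun n (a : Γ) => f n = (a : WithTop Γ))
        (h.mono fun n hn => by
        obtain ⟨a, ha⟩ := WithTop.ne_top_iff_exists.1 hn
        exact ⟨a, ha.symm⟩))
    · refine Or.inl (Eventually.of_forall fun n => ?_)
      by_contra h0
      obtain ⟨a, -⟩ := WithTop.ne_top_iff_exists.1 h0
      exact hΓ ⟨a⟩

variable {G : Submodule ℚ (Ultrapower Γ × Ultrapower Γ)}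

omit [LinearOrder Γ] [IsOrderedAddMonoid Γ] [AsymptoticCouple Γ] in
theorem Corresp.mono {G' : Submodule ℚ (Ultrapower Γ × Ultrapower Γ)} (h : G ≤ G')
    {f g : ℕ → WithTop Γ} (hfg : Corresp G f g) : Corresp G' f g :=
  hfg.imp_right fun ⟨a, b, h1, h2⟩ => ⟨a, b, h1, h h2⟩

omit [LinearOrder Γ] [IsOrderedAddMonoid Γ] [AsymptoticCouple Γ] in
theorem Corresp.congr {f g f' g' : ℕ → WithTop Γ} (hfg : Corresp G f g)
    (hf : ∀ᶠ n in (hyperfilter ℕ : Filter ℕ), f' n = f n)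
    (hg : ∀ᶠ n in (hyperfilter ℕ : Filter ℕ), g' n = g n) : Corresp G f' g' := by
  rcases hfg with h | ⟨a, b, h, hab⟩
  · left
    filter_upwards [hf, hg, h] with n h1 h2 h3
    rw [h1, h2]; exact h3
  · refine Or.inr ⟨a, b, ?_, hab⟩
    filter_upwards [hf, hg, h] with n h1 h2 h3
    rw [h1, h2]; exact h3

omit [LinearOrder Γ] [IsOrderedAddMonoid Γ] [AsymptoticCouple Γ] in
theorem Corresp.map {f g : ℕ → WithTop Γ} (hfg : Corresp G f g) {F : WithTop Γ → WithTop Γ}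
    (htop : F ⊤ = ⊤) (h : ∀ a b : ℕ → Γ, ((a : Ultrapower Γ), (b : Ultrapower Γ)) ∈ G →
      Corresp G (fun n => F (a n)) (fun n => F (b n))) :
    Corresp G (fun n => F (f n)) (fun n => F (g n)) := by
  rcases hfg with hfg | ⟨a, b, hfg, hab⟩
  · left
    filter_upwards [hfg] with n h1
    rw [h1.1, h1.2, htop]; exact ⟨rfl, rfl⟩
  · refine (h a b hab).congr ?_ ?_
    · filter_upwards [hfg] with n h1
      rw [h1.1]
    · filter_upwards [hfg] with n h1
      rw [h1.2]

variable (hG : IsPartialIso G)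

include hG in
theorem Corresp.compare {f g f' g' : ℕ → WithTop Γ} (h : Corresp G f g) (h' : Corresp G f' g') :
    ((∀ᶠ n in (hyperfilter ℕ : Filter ℕ), f n = f' n) ↔
      ∀ᶠ n in (hyperfilter ℕ : Filter ℕ), g n = g' n) ∧
    ((∀ᶠ n in (hyperfilter ℕ : Filter ℕ), f n < f' n) ↔
      ∀ᶠ n in (hyperfilter ℕ : Filter ℕ), g n < g' n) := by
  have key : ∀ {p q : ℕ → Prop}, (∀ᶠ n in (hyperfilter ℕ : Filter ℕ), p n ↔ q n) →
      ((∀ᶠ n in (hyperfilter ℕ : Filter ℕ), p n) ↔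
        ∀ᶠ n in (hyperfilter ℕ : Filter ℕ), q n) := fun h => eventually_congr h
  rcases h with h | ⟨a, b, h, hab⟩ <;> rcases h' with h' | ⟨a', b', h', hab'⟩
  · constructor <;> refine key ?_ <;> filter_upwards [h, h'] with n h1 h2 <;>
      simp [h1.1, h1.2, h2.1, h2.2]
  · constructor <;> refine key ?_ <;> filter_upwards [h, h'] with n h1 h2 <;>
      simp [h1.1, h1.2, h2.1, h2.2]
  · constructor <;> refine key ?_ <;> filter_upwards [h, h'] with n h1 h2 <;>
      simp [h1.1, h1.2, h2.1, h2.2]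
  · have e1 := hG.eq_iff hab hab'
    have e2 := hG.lt_iff hab hab'
    dsimp only at e1 e2
    rw [Ultrapower.coe_eq_iff, Ultrapower.coe_eq_iff] at e1
    rw [Germ.coe_lt, Germ.coe_lt] at e2
    constructor
    · refine Iff.trans (key ?_) (e1.trans (key ?_)) <;> filter_upwards [h, h'] with n h1 h2 <;>
        simp [h1.1, h1.2, h2.1, h2.2]
    · refine Iff.trans (key ?_) (e2.trans (key ?_)) <;> filter_upwards [h, h'] with n h1 h2 <;>
        simp [h1.1, h1.2, h2.1, h2.2]

include hG in
theorem corresp_psiTop {a b : ℕ → Γ} (h : ((a : Ultrapower Γ), (b : Ultrapower Γ)) ∈ G) :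
    Corresp G (fun n => psiTop (a n : WithTop Γ)) (fun n => psiTop (b n : WithTop Γ)) := by
  have h0 := hG.ne_zero_iff h
  by_cases ha : (a : Ultrapower Γ) = 0
  · have hb : (b : Ultrapower Γ) = 0 := not_not.1 fun hb => h0.2 hb ha
    have ha := (Ultrapower.coe_eq_iff (g := 0)).1 ha
    have hb := (Ultrapower.coe_eq_iff (g := 0)).1 hb
    left
    filter_upwards [ha, hb] with n h1 h2
    simp [psiTop, h1, h2]
  · have h1 := hG.psi_mem _ h ha
    have hb := Ultrapower.coe_ne_zero_iff.1 (h0.1 ha)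
    have ha := Ultrapower.coe_ne_zero_iff.1 ha
    refine Or.inr ⟨fun n => psi (a n), fun n => psi (b n), ?_, h1⟩
    filter_upwards [ha, hb] with n h1 h2
    exact ⟨psiTop_coe h1, psiTop_coe h2⟩

variable (hM : IsModelTlog Γ)

include hG hM in
-- Lying in `Ψ` above `s0` is preserved in both directions, so `p` takes the value `∞` on both sides
-- or on neither.
theorem corresp_pred {a b : ℕ → Γ} (h : ((a : Ultrapower Γ), (b : Ultrapower Γ)) ∈ G) :
    Corresp G (fun n => pred (a n : WithTop Γ)) (fun n => pred (b n : WithTop Γ)) := by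
  have hM' := hM.ultrapower
  have hmem : (a : Ultrapower Γ) ∈ Psi (Ultrapower Γ) ↔ (b : Ultrapower Γ) ∈ Psi (Ultrapower Γ) :=
    ⟨hG.snd_mem_Psi hM' h, hG.swap.snd_mem_Psi hM' (z := ((b : Ultrapower Γ), _)) h⟩
  have hlt := hG.lt_iff hG.zero_mem h
  by_cases ha : (a : Ultrapower Γ) ∈ Psi (Ultrapower Γ) ∧ succ 0 < (a : Ultrapower Γ)
  · have hb : (b : Ultrapower Γ) ∈ Psi (Ultrapower Γ) ∧ succ 0 < (b : Ultrapower Γ) :=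
      ⟨hmem.1 ha.1, hlt.1 ha.2⟩
    obtain ⟨u, hu, h1⟩ := hM'.exists_pred ha.1 ha.2.ne'
    obtain ⟨v, hv, h2⟩ := hM'.exists_pred hb.1 hb.2.ne'
    have h3 : (u, v) ∈ G := hG.pred_mem u hu v hv (by rw [h1, h2]; exact h)
    obtain ⟨u, rfl⟩ := Ultrapower.exists_coe u
    obtain ⟨v, rfl⟩ := Ultrapower.exists_coe v
    rw [hM.succ_coe, Ultrapower.coe_eq_iff] at h1 h2
    rw [Ultrapower.coe_mem_Psi] at hu hv
    refine Or.inr ⟨u, v, ?_, h3⟩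
    filter_upwards [h1, h2, hu, hv] with n h1 h2 h3 h4
    rw [← h1, ← h2]
    exact ⟨pred_coe_succ hM h3, pred_coe_succ hM h4⟩
  · have hb : ¬((b : Ultrapower Γ) ∈ Psi (Ultrapower Γ) ∧ succ 0 < (b : Ultrapower Γ)) :=
      fun hb => ha ⟨hmem.2 hb.1, hlt.2 hb.2⟩
    rw [Ultrapower.coe_mem_Psi, hM.succ_zero_ultrapower, Germ.coe_lt, ← eventually_and,
      ← Ultrafilter.eventually_not] at ha hb
    left
    filter_upwards [ha, hb] with n h1 h2
    exact ⟨if_neg h1, if_neg h2⟩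

include hG hM in
theorem corresp_realize_term {β : Type*} (t : Llog.Term β) {v w : ℕ → β → WithTop Γ}
    (h : ∀ i, Corresp G (fun n => v n i) (fun n => w n i)) :
    Corresp G (fun n => t.realize (v n)) (fun n => t.realize (w n)) := by
  induction t with
  | var i => exact h i
  | func f ts ih =>
    cases f with
    | zero => exact Or.inr ⟨0, 0, Eventually.of_forall fun n => ⟨rfl, rfl⟩, G.zero_mem⟩
    | infty => exact Or.inl (Eventually.of_forall fun n => ⟨rfl, rfl⟩)
    | neg =>
      exact (ih 0).map (F := WithTop.map fun γ : Γ => -γ) rfl fun a b hab =>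
        Or.inr ⟨-a, -b, Eventually.of_forall fun n => ⟨rfl, rfl⟩, G.neg_mem hab⟩
    | psi => exact (ih 0).map (F := psiTop) rfl fun a b hab => corresp_psiTop hG hab
    | succ =>
      refine (ih 0).map (F := WithTop.map fun γ : Γ => succ γ) rfl fun a b hab =>
        Or.inr ⟨fun n => succ (a n), fun n => succ (b n),
          Eventually.of_forall fun n => ⟨rfl, rfl⟩, ?_⟩
      rw [← hM.succ_coe, ← hM.succ_coe]
      exact hG.succ_mem _ hab
    | pred => exact (ih 0).map (F := pred) rfl fun a b hab => corresp_pred hG hM hab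
    | delta k =>
      refine (ih 0).map (F := WithTop.map fun γ : Γ => divNat (k : ℕ) γ) rfl fun a b hab =>
        Or.inr ⟨((k : ℕ) : ℚ)⁻¹ • a, ((k : ℕ) : ℚ)⁻¹ • b, Eventually.of_forall fun n => ?_,
          G.smul_mem ((k : ℕ) : ℚ)⁻¹ hab⟩
      simp [divNat_eq k.ne_zero]
    | add =>
      change Corresp G (fun n => (ts 0).realize (v n) + (ts 1).realize (v n))
        (fun n => (ts 0).realize (w n) + (ts 1).realize (w n))
      rcases ih 0 with h0 | ⟨a, b, h0, hab⟩
      · left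
        filter_upwards [h0] with n h1
        simp [h1.1, h1.2]
      rcases ih 1 with h1 | ⟨a', b', h1, hab'⟩
      · left
        filter_upwards [h1] with n h1
        simp [h1.1, h1.2]
      · refine Or.inr ⟨a + a', b + b', ?_, G.add_mem hab hab'⟩
        filter_upwards [h0, h1] with n h0 h1
        simp [h0.1, h0.2, h1.1, h1.2]

include hG hM in
theorem exists_corresp_fst (hc : (G : Set (Ultrapower Γ × Ultrapower Γ)).Countable)
    (f : ℕ → WithTop Γ) : ∃ G' : Submodule ℚ (Ultrapower Γ × Ultrapower Γ), IsPartialIso G' ∧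
      (G' : Set (Ultrapower Γ × Ultrapower Γ)).Countable ∧ G ≤ G' ∧ ∃ g, Corresp G' f g := by
  rcases eventually_eq_top_or_coe f with hf | ⟨a, hf⟩
  · exact ⟨G, hG, hc, le_rfl, fun _ => ⊤, Or.inl (hf.mono fun n h => ⟨h, rfl⟩)⟩
  · obtain ⟨G', h1, h2, h3, b, h4⟩ :=
      hG.exists_fst hM.ultrapower isCountablySaturated_ultrapower hc a
    obtain ⟨b, rfl⟩ := Ultrapower.exists_coe b
    exact ⟨G', h1, h2, h3, fun n => b n, Or.inr ⟨a, b, hf.mono fun n h => ⟨h, rfl⟩, h4⟩⟩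

include hG hM in
theorem exists_corresp_snd (hc : (G : Set (Ultrapower Γ × Ultrapower Γ)).Countable)
    (g : ℕ → WithTop Γ) : ∃ G' : Submodule ℚ (Ultrapower Γ × Ultrapower Γ), IsPartialIso G' ∧
      (G' : Set (Ultrapower Γ × Ultrapower Γ)).Countable ∧ G ≤ G' ∧ ∃ f, Corresp G' f g := by
  rcases eventually_eq_top_or_coe g with hg | ⟨b, hg⟩
  · exact ⟨G, hG, hc, le_rfl, fun _ => ⊤, Or.inl (hg.mono fun n h => ⟨rfl, h⟩)⟩
  · obtain ⟨G', h1, h2, h3, a, h4⟩ :=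
      hG.exists_snd hM.ultrapower isCountablySaturated_ultrapower hc b
    obtain ⟨a, rfl⟩ := Ultrapower.exists_coe a
    exact ⟨G', h1, h2, h3, fun n => a n, Or.inr ⟨a, b, hg.mono fun n h => ⟨rfl, h⟩, h4⟩⟩

omit [LinearOrder Γ] [IsOrderedAddMonoid Γ] [AsymptoticCouple Γ] in
theorem Corresp.snoc {m : ℕ} {xs ys : ℕ → Fin m → WithTop Γ} {f g : ℕ → WithTop Γ}
    (h : ∀ i, Corresp G (fun n => xs n i) (fun n => ys n i)) (hfg : Corresp G f g)
    (i : Fin (m + 1)) : Corresp G (fun n => (Fin.snoc (xs n) (f n) : Fin (m + 1) → WithTop Γ) i)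
      (fun n => (Fin.snoc (ys n) (g n) : Fin (m + 1) → WithTop Γ) i) := by
  refine Fin.lastCases ?_ (fun j => ?_) i
  · simpa using hfg
  · simpa using h j

include hM in
-- Truth at almost all indices is compared directly, by induction on the formula. Implication uses
-- that the filter is an ultrafilter. For a quantifier, counterexamples are chosen index by index
-- and the resulting sequence is matched by enlarging `G`, which is why `G` is universally
-- quantified inside the induction.
theorem eventually_realize_iff {β : Type*} {m : ℕ} (φ : Llog.BoundedFormula β m) :
    ∀ {G : Submodule ℚ (Ultrapower Γ × Ultrapower Γ)}, IsPartialIso G →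
      (G : Set (Ultrapower Γ × Ultrapower Γ)).Countable → ∀ {v w : ℕ → β → WithTop Γ}
      {xs ys : ℕ → Fin m → WithTop Γ}, (∀ i, Corresp G (fun n => v n i) (fun n => w n i)) →
      (∀ i, Corresp G (fun n => xs n i) (fun n => ys n i)) →
      ((∀ᶠ n in (hyperfilter ℕ : Filter ℕ), φ.Realize (v n) (xs n)) ↔
        ∀ᶠ n in (hyperfilter ℕ : Filter ℕ), φ.Realize (w n) (ys n)) := by
  induction φ with
  | falsum => exact fun _ _ _ _ _ _ _ _ => Iff.rfl
  | equal t₁ t₂ =>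
    intro G hG hc v w xs ys hv hx
    have hs : ∀ i, Corresp G (fun n => Sum.elim (v n) (xs n) i)
        (fun n => Sum.elim (w n) (ys n) i) := fun i => by cases i <;> simp [hv, hx]
    exact ((corresp_realize_term hG hM t₁ hs).compare hG (corresp_realize_term hG hM t₂ hs)).1
  | rel R ts =>
    intro G hG hc v w xs ys hv hx
    have hs : ∀ i, Corresp G (fun n => Sum.elim (v n) (xs n) i)
        (fun n => Sum.elim (w n) (ys n) i) := fun i => by cases i <;> simp [hv, hx]
    cases R
    exact ((corresp_realize_term hG hM (ts 0) hs).compare hG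
      (corresp_realize_term hG hM (ts 1) hs)).2
  | imp φ ψ ih₁ ih₂ =>
    intro G hG hc v w xs ys hv hx
    simp only [Language.BoundedFormula.realize_imp, Ultrafilter.eventually_imp]
    rw [ih₁ hG hc hv hx, ih₂ hG hc hv hx]
  | all φ ih =>
    intro G hG hc v w xs ys hv hx
    simp only [Language.BoundedFormula.realize_all]
    constructor
    · intro h
      by_contra hcon
      rw [← Ultrafilter.eventually_not] at hcon
      obtain ⟨g, hg⟩ := Eventually.choice (r := fun n a => ¬φ.Realize (w n) (Fin.snoc (ys n) a))
        (hcon.mono fun n hn => not_forall.1 hn)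
      obtain ⟨G', hG', hc', hle, f, hf⟩ := exists_corresp_snd hG hM hc g
      have h1 := (ih hG' hc' (fun i => (hv i).mono hle)
        (Corresp.snoc (fun i => (hx i).mono hle) hf)).1 (h.mono fun n hn => hn _)
      obtain ⟨n, h2, h3⟩ := (h1.and hg).exists
      exact h3 h2
    · intro h
      by_contra hcon
      rw [← Ultrafilter.eventually_not] at hcon
      obtain ⟨f, hf⟩ := Eventually.choice (r := fun n a => ¬φ.Realize (v n) (Fin.snoc (xs n) a))
        (hcon.mono fun n hn => not_forall.1 hn)
      obtain ⟨G', hG', hc', hle, g, hg⟩ := exists_corresp_fst hG hM hc f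
      have h1 := (ih hG' hc' (fun i => (hv i).mono hle)
        (Corresp.snoc (fun i => (hx i).mono hle) hg)).2 (h.mono fun n hn => hn _)
      obtain ⟨n, h2, h3⟩ := (h1.and hf).exists
      exact h3 h2

end Corresp

/-! ### The rational structure of a divisible group -/

section RatModule

/-- A divisible ordered abelian group is a vector space over `ℚ`. -/
abbrev ratModule {Γ : Type*} [AddCommGroup Γ] [LinearOrder Γ] [IsOrderedAddMonoid Γ]
    (h : IsDivisible Γ) : Module ℚ Γ :=
  -- A divisible group coincides with its divisible hull, whose rational structure is transported
  -- back.
  have hbij : Function.Bijective (DivisibleHull.coeAddMonoidHom Γ) :=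
    ⟨DivisibleHull.coe_injective, fun x => by
      induction x with
      | mk m t =>
        obtain ⟨γ, hγ⟩ := h t t.ne_zero m
        exact ⟨γ, DivisibleHull.mk_eq_mk.2 ⟨1, by simpa using hγ⟩⟩⟩
  let e := AddEquiv.ofBijective (DivisibleHull.coeAddMonoidHom Γ) hbij
  letI : SMul ℚ Γ := ⟨fun q x => e.symm (q • e x)⟩
  e.injective.module ℚ e.toAddMonoidHom fun q x => e.apply_symm_apply (q • e x)

end RatModule

/-! ### Definable sets depend on finitely many cut points -/

section Cuts

open Filter

variable {Γ : Type*} [AddCommGroup Γ] [LinearOrder Γ] [IsOrderedAddMonoid Γ] [AsymptoticCouple Γ]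
  [Module ℚ Γ]

/-- The diagonal embedding of a subspace into the square of the ultrapower. -/
def diagonalPart (K : Submodule ℚ Γ) : Submodule ℚ (Ultrapower Γ × Ultrapower Γ) :=
  let c : Γ →ₗ[ℚ] Ultrapower Γ :=
    { toFun := fun k => ((fun _ => k : ℕ → Γ) : Ultrapower Γ)
      map_add' := fun _ _ => rfl
      map_smul' := fun _ _ => rfl }
  K.map (c.prod c)

omit [LinearOrder Γ] [IsOrderedAddMonoid Γ] [AsymptoticCouple Γ] in
theorem countable_diagonalPart {K : Submodule ℚ Γ} (hK : (K : Set Γ).Countable) :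
    (diagonalPart K : Set (Ultrapower Γ × Ultrapower Γ)).Countable := hK.image _

theorem isPartialIso_diagonalPart (hM : IsModelTlog Γ) {K : Submodule ℚ Γ} (hK : IsSubcouple K) :
    IsPartialIso (diagonalPart K) where
  pos_iff := by
    rintro z ⟨k, hk, rfl⟩
    exact Iff.rfl
  psi_mem := by
    rintro z ⟨k, hk, rfl⟩ h0
    refine ⟨psi k, hK.psi_mem k hk ?_, rfl⟩
    rintro rfl
    exact h0 rfl
  succ_mem := by
    rintro z ⟨k, hk, rfl⟩
    exact ⟨succ k, hK.succ_mem k hk, Prod.ext (hM.succ_coe _).symm (hM.succ_coe _).symm⟩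
  pred_mem := by
    rintro u hu v hv ⟨k, hk, h⟩
    have h1 : ((fun _ => k : ℕ → Γ) : Ultrapower Γ) = succ u := congrArg Prod.fst h
    have h2 : ((fun _ => k : ℕ → Γ) : Ultrapower Γ) = succ v := congrArg Prod.snd h
    have h3 : u = v := hM.ultrapower.succ_inj hu hv (h1.symm.trans h2)
    obtain ⟨f, rfl⟩ := Ultrapower.exists_coe u
    rw [hM.succ_coe, Ultrapower.coe_eq_iff] at h1
    have hf := Ultrapower.coe_mem_Psi.1 hu
    -- A germ in `Ψ` whose successor is the constant `k` is itself constant, since `s` is injective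
    -- on `Ψ`; any good index supplies its value.
    obtain ⟨n, h4, h5⟩ := (h1.and hf).exists
    have h6 : ((fun _ => f n : ℕ → Γ) : Ultrapower Γ) = f := by
      refine Ultrapower.coe_eq_iff.2 ?_
      filter_upwards [h1, hf] with i h7 h8
      exact hM.succ_inj h5 h8 (h4.symm.trans h7)
    exact ⟨f n, hK.pred_mem _ h5 (h4 ▸ hk), Prod.ext h6 (h6.trans h3)⟩

omit [Module ℚ Γ] in
-- Strict inequalities reduce to weak ones at the successor, so the conditions `e ≤ x` capture whole
-- cuts and half-open intervals suffice.
theorem IsModelTlog.lt_iff_succ_le (hM : IsModelTlog Γ) {u v : Γ} (hu : u ∈ Psi Γ)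
    (hv : v ∈ Psi Γ) : u < v ↔ succ u ≤ v :=
  ⟨(hM.succ_spec u hu).2.2 v hv, (hM.succ_spec u hu).2.1.trans_le⟩

/-- Sequences in `Ψ` that realize the same cut in a countable subcouple correspond to each other
under a partial automorphism fixing that subcouple. -/
theorem exists_mem_of_eventually_le_iff (hM : IsModelTlog Γ) {K : Submodule ℚ Γ}
    (hK : IsSubcouple K) (hKc : (K : Set Γ).Countable) {x y : ℕ → Γ} (hx : ∀ n, x n ∈ Psi Γ)
    (hy : ∀ n, y n ∈ Psi Γ) (h : ∀ e ∈ K, e ∈ Psi Γ →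
      ∀ᶠ n in (hyperfilter ℕ : Filter ℕ), (e ≤ x n ↔ e ≤ y n)) :
    ∃ G : Submodule ℚ (Ultrapower Γ × Ultrapower Γ), IsPartialIso G ∧
      (G : Set (Ultrapower Γ × Ultrapower Γ)).Countable ∧ diagonalPart K ≤ G ∧
      ((x : Ultrapower Γ), (y : Ultrapower Γ)) ∈ G := by
  have hG := isPartialIso_diagonalPart hM hK
  have hGc := countable_diagonalPart hKc
  have hlt : ∀ e ∈ K, e ∈ Psi Γ →
      ∀ᶠ n in (hyperfilter ℕ : Filter ℕ), (e < x n ↔ e < y n) := fun e he heΨ => by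
    filter_upwards [h _ (hK.succ_mem e he) (hM.succ_mem e)] with n hn
    rw [hM.lt_iff_succ_le heΨ (hx n), hM.lt_iff_succ_le heΨ (hy n), hn]
  have heq : ∀ e ∈ K, e ∈ Psi Γ →
      ∀ᶠ n in (hyperfilter ℕ : Filter ℕ), (e = x n ↔ e = y n) := fun e he heΨ => by
    filter_upwards [h e he heΨ, hlt e he heΨ] with n h1 h2
    rw [eq_iff_le_not_lt, eq_iff_le_not_lt, h1, h2]
  have hconst : ∀ e : Γ, ((fun _ => e : ℕ → Γ) : Ultrapower Γ) ∈ Psi (Ultrapower Γ) →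
      e ∈ Psi Γ := fun e he => (Ultrapower.coe_mem_Psi.1 he).exists.choose_spec
  -- If the germ of `x` is a constant from `K`, the germ of `y` is the same constant and the
  -- diagonal already contains the pair. Otherwise both germs avoid `K ∩ Ψ` and fill the same cut.
  by_cases hex : ∃ e ∈ K, e ∈ Psi Γ ∧ ((fun _ => e : ℕ → Γ) : Ultrapower Γ) = x
  · obtain ⟨e, he, heΨ, hex⟩ := hex
    refine ⟨_, hG, hGc, le_rfl, e, he, Prod.ext hex ?_⟩
    exact Ultrapower.coe_eq_iff.2 ((eventually_congr (heq e he heΨ)).1 (Ultrapower.coe_eq_iff.1 hex))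
  · refine hG.exists_mem_of_cutMatch hM.ultrapower isCountablySaturated_ultrapower hGc
      (Ultrapower.coe_mem_Psi.2 (Eventually.of_forall hx))
      (Ultrapower.coe_mem_Psi.2 (Eventually.of_forall hy)) ?_
    rintro z ⟨⟨e, he, rfl⟩, heΨ, -⟩
    have heΨ := hconst e heΨ
    refine ⟨fun h0 => hex ⟨e, he, heΨ, h0⟩, fun h0 => hex ⟨e, he, heΨ, ?_⟩, ?_⟩
    · exact Ultrapower.coe_eq_iff.2
        ((eventually_congr (heq e he heΨ)).2 (Ultrapower.coe_eq_iff.1 h0))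
    · exact Germ.coe_lt.trans ((eventually_congr (hlt e he heΨ)).trans Germ.coe_lt.symm)

/-- Otherwise, for an enumeration of `K ∩ Ψ` with `K` a countable subcouple containing the finite
parameters, each initial segment admits `x ∈ A` and `y ∉ A` in the same cut. The germs of these
sequences lie in the same cut over `K`, hence correspond under a partial automorphism fixing the
parameters. This contradicts the invariance of formulas. -/
theorem exists_finset_determining (hM : IsModelTlog Γ) {A : Set (WithTop Γ)}
    (hA : (Set.univ : Set (WithTop Γ)).Definable₁ Llog A) :
    ∃ E : Finset Γ, (∀ e ∈ E, e ∈ Psi Γ) ∧ ∀ x ∈ Psi Γ, ∀ y ∈ Psi Γ,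
      (∀ e ∈ E, e ≤ x ↔ e ≤ y) → (x : WithTop Γ) ∈ A → (y : WithTop Γ) ∈ A := by
  classical
  obtain ⟨B, -, hB⟩ := Set.definable_iff_finitely_definable.1 hA
  obtain ⟨φ, hφ⟩ := Set.definable_iff_exists_formula_sum.1 hB
  let d : Fin 0 → WithTop Γ := fun i => i.elim0
  have hφ' : ∀ x : WithTop Γ, x ∈ A ↔
      Language.BoundedFormula.Realize φ (Sum.elim (fun b => (b : WithTop Γ)) fun _ => x) d :=
    fun x => by
      refine (Set.ext_iff.1 hφ fun _ => x).trans ?_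
      change Language.BoundedFormula.Realize φ _ _ ↔ _
      rw [Subsingleton.elim d]
  obtain ⟨K, hK, hKc, hBK⟩ := hM.exists_countable_subcouple
    (B := {x : Γ | (x : WithTop Γ) ∈ B})
    (B.countable_toSet.preimage WithTop.coe_injective)
  by_contra! hcon
  obtain ⟨e, he⟩ := (hKc.mono (Set.inter_subset_left (t := Psi Γ))).exists_eq_range
    ⟨succ 0, hK.succ_mem 0 K.zero_mem, hM.succ_mem 0⟩
  have hemem : ∀ n, e n ∈ (K : Set Γ) ∩ Psi Γ := fun n => he ▸ ⟨n, rfl⟩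
  choose x hx y hy hxy hxA hyA using fun N : ℕ =>
    hcon ((Finset.range (N + 1)).image e) fun a ha => by
      obtain ⟨n, -, rfl⟩ := Finset.mem_image.1 ha
      exact (hemem n).2
  obtain ⟨G, hG, hGc, hKG, hxyG⟩ := exists_mem_of_eventually_le_iff hM hK hKc hx hy
    fun a ha haΨ => by
      obtain ⟨m, rfl⟩ : a ∈ Set.range e := he ▸ ⟨ha, haΨ⟩
      have h1 : ∀ᶠ n in cofinite, m ≤ n := Nat.cofinite_eq_atTop ▸ eventually_ge_atTop m
      filter_upwards [h1.filter_mono hyperfilter_le_cofinite] with n hn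
      exact hxy n _ (Finset.mem_image_of_mem e (Finset.mem_range.2 (by omega)))
  have key := eventually_realize_iff hM φ hG hGc
    (v := fun n => Sum.elim (fun b => (b : WithTop Γ)) fun _ => (x n : WithTop Γ))
    (w := fun n => Sum.elim (fun b => (b : WithTop Γ)) fun _ => (y n : WithTop Γ))
    (xs := fun _ => d) (ys := fun _ => d) (by
      rintro (⟨b, hb⟩ | i)
      · induction b using WithTop.recTopCoe with
        | top => exact Or.inl (Eventually.of_forall fun n => ⟨rfl, rfl⟩)
        | coe b => exact Or.inr ⟨fun _ => b, fun _ => b, Eventually.of_forall fun n => ⟨rfl, rfl⟩,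
            hKG ⟨b, hBK hb, rfl⟩⟩
      · exact Or.inr ⟨x, y, Eventually.of_forall fun n => ⟨rfl, rfl⟩, hxyG⟩)
    (fun i => i.elim0)
  obtain ⟨n, hn⟩ := (key.1 (Eventually.of_forall fun n => (hφ' _).1 (hxA n))).exists
  exact hyA n ((hφ' _).2 hn)

end Cuts

/-! ### Decomposition into half-open intervals -/

section Intervals

variable {Γ : Type*} [AddCommGroup Γ] [LinearOrder Γ] [IsOrderedAddMonoid Γ] [AsymptoticCouple Γ]

theorem exists_finite_intervals (hM : IsModelTlog Γ) {A : Set (WithTop Γ)} (hAΨ : A ⊆ PsiTop Γ)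
    (hA : (Set.univ : Set (WithTop Γ)).Definable₁ Llog A) :
    ∃ F : Set (Set (WithTop Γ)), F.Finite ∧ A = ⋃₀ F ∧ ∀ I ∈ F, IsPsiInterval Γ I := by
  classical
  let _ := ratModule hM.divisible
  obtain ⟨E₀, hE₀Ψ, hE₀⟩ := exists_finset_determining hM hA
  -- Adding the least element of `Ψ` guarantees that every point of `Ψ` has a largest element of `E`
  -- at or below it.
  let E := insert (succ 0) E₀
  have hEΨ : ∀ e ∈ E, e ∈ Psi Γ := fun e he => by
    rcases Finset.mem_insert.1 he with rfl | he
    · exact hM.succ_mem 0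
    · exact hE₀Ψ e he
  -- The next point of `E`; the empty infimum gives `∞` at the last one.
  let nxt : Γ → WithTop Γ := fun e => (E.filter fun f => e < f).inf fun f => (f : WithTop Γ)
  let I : Γ → Set (WithTop Γ) := fun e => {x ∈ PsiTop Γ | (e : WithTop Γ) ≤ x ∧ x < nxt e}
  have hnxt : ∀ (e x : Γ), (x : WithTop Γ) < nxt e ↔ ∀ f ∈ E, e < f → x < f := fun e x => by
    simp [nxt, Finset.lt_inf_iff (WithTop.coe_lt_top x)]
  refine ⟨I '' {e | e ∈ E ∧ (I e ∩ A).Nonempty},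
    (E.finite_toSet.subset fun e he => he.1).image _, ?_, ?_⟩
  · ext x
    constructor
    · intro hx
      obtain ⟨ξ, hξ, rfl⟩ := hAΨ hx
      obtain ⟨e, he, hmax⟩ := (E.filter fun e => e ≤ ξ).exists_max_image id
        ⟨succ 0, Finset.mem_filter.2 ⟨Finset.mem_insert_self _ _, hM.isLeast.2 hξ⟩⟩
      obtain ⟨heE, heξ⟩ := Finset.mem_filter.1 he
      have hmem : (ξ : WithTop Γ) ∈ I e := by
        refine ⟨⟨ξ, hξ, rfl⟩, WithTop.coe_le_coe.2 heξ, (hnxt e ξ).2 fun f hf hef => ?_⟩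
        by_contra! hfξ
        exact (hmax f (Finset.mem_filter.2 ⟨hf, hfξ⟩)).not_gt hef
      exact ⟨I e, ⟨e, ⟨heE, _, hmem, hx⟩, rfl⟩, hmem⟩
    · rintro ⟨_, ⟨e, ⟨heE, y, hyI, hyA⟩, rfl⟩, hxI⟩
      obtain ⟨η, hη, rfl⟩ := hyI.1
      obtain ⟨ξ, hξ, rfl⟩ := hxI.1
      refine hE₀ η hη ξ hξ (fun f hf => ?_) hyA
      have hfE : f ∈ E := Finset.mem_insert_of_mem hf
      rcases le_or_gt f e with hfe | hfe
      · exact iff_of_true (hfe.trans (WithTop.coe_le_coe.1 hyI.2.1))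
          (hfe.trans (WithTop.coe_le_coe.1 hxI.2.1))
      · exact iff_of_false ((hnxt e η).1 hyI.2.2 f hfE hfe).not_ge
          ((hnxt e ξ).1 hxI.2.2 f hfE hfe).not_ge
  · rintro _ ⟨e, ⟨heE, x, hx, -⟩, rfl⟩
    refine ⟨e, Or.inl ⟨e, hEΨ e heE, rfl⟩, nxt e, ?_, hx.2.1.trans_lt hx.2.2, rfl⟩
    rcases (E.filter fun f => e < f).eq_empty_or_nonempty with h | h
    · exact Or.inr (by simp [nxt, h])
    · obtain ⟨f, hf, h1⟩ := Finset.exists_mem_eq_inf _ h fun f => (f : WithTop Γ)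
      exact Or.inl ⟨f, hEΨ f (Finset.mem_filter.1 hf).1, h1.symm⟩

end Intervals

/-! ### Definability in the induced structure -/

section InducedDefinability

universe u v w

variable {L : FirstOrder.Language.{u, v}} {M : Type w} [L.Structure M] {P : Set M}

theorem exists_eq_var_of_inducedLanguage {β : Type*} (t : (inducedLanguage L P).Term β) :
    ∃ i, t = Language.Term.var i := by
  cases t with
  | var i => exact ⟨i, rfl⟩
  | func f ts => exact f.elim

/-- Sets definable in the structure induced on a definable set are traces of definable sets. -/
theorem exists_definable_of_inducedLanguage (hP : (Set.univ : Set M).Definable₁ L P)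
    {α : Type*} [Finite α] {m : ℕ} (φ : (inducedLanguage L P).BoundedFormula α m) :
    ∃ D : Set (α ⊕ Fin m → M), (Set.univ : Set M).Definable L D ∧
      ∀ (v : α → P) (xs : Fin m → P), φ.Realize v xs ↔ (fun i => ((Sum.elim v xs i : P) : M)) ∈ D := by
  induction φ with
  | falsum => exact ⟨∅, Set.definable_empty, fun v xs => Iff.rfl⟩
  | equal t₁ t₂ =>
    obtain ⟨i, rfl⟩ := exists_eq_var_of_inducedLanguage t₁
    obtain ⟨j, rfl⟩ := exists_eq_var_of_inducedLanguage t₂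
    refine ⟨{x | x i = x j}, ⟨(Language.Term.var i).equal (Language.Term.var j), ?_⟩,
      fun v xs => ?_⟩
    · ext x
      simp [Language.Formula.realize_equal]
    · exact Subtype.ext_iff
  | rel R ts =>
    choose ι hι using fun k => exists_eq_var_of_inducedLanguage (ts k)
    obtain ⟨R, D, hD, rfl⟩ := R
    refine ⟨_, hD.preimage_comp ι, fun v xs => ?_⟩
    obtain rfl : ts = fun k => Language.Term.var (ι k) := funext hι
    exact Iff.rfl
  | imp φ ψ ih₁ ih₂ =>
    obtain ⟨D₁, hD₁, h₁⟩ := ih₁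
    obtain ⟨D₂, hD₂, h₂⟩ := ih₂
    refine ⟨D₁ᶜ ∪ D₂, hD₁.compl.union hD₂, fun v xs => ?_⟩
    rw [Language.BoundedFormula.realize_imp, h₁, h₂, imp_iff_not_or]
    rfl
  | @all m φ ih =>
    obtain ⟨D, hD, h⟩ := ih
    let f : α ⊕ Fin m → α ⊕ Fin (m + 1) := Sum.map id Fin.castSucc
    -- A quantifier of the induced structure ranges over `P`, so it becomes a projection relativized
    -- to `P`. This is where definability of `P` is used.
    have hP' : (Set.univ : Set M).Definable L
        {x : α ⊕ Fin (m + 1) → M | x (Sum.inr (Fin.last m)) ∈ P} :=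
      hP.preimage_comp fun _ : Fin 1 => (Sum.inr (Fin.last m) : α ⊕ Fin (m + 1))
    refine ⟨_, ((hP'.inter hD.compl).image_comp f).compl, fun v xs => ?_⟩
    have hsum : ∀ (a : P), ((fun i => ((Sum.elim v (Fin.snoc xs a : Fin (m + 1) → P) i : P) : M)) ∘ f) =
        fun i => ((Sum.elim v xs i : P) : M) := fun a => by
      funext i
      cases i <;> simp [f]
    rw [Language.BoundedFormula.realize_all, Set.mem_compl_iff, ← not_iff_not, not_not, not_forall]
    constructor
    · rintro ⟨a, ha⟩
      rw [h] at ha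
      exact ⟨_, ⟨by simp, ha⟩, hsum a⟩
    · rintro ⟨x, ⟨hxP, hxD⟩, hx⟩
      refine ⟨⟨_, hxP⟩, ?_⟩
      rw [h]
      convert! hxD using 1
      congr! 2 with i
      rcases i with i | i
      · exact (congrFun hx (Sum.inl i)).symm
      · refine Fin.lastCases ?_ (fun j => ?_) i
        · simp
        · simpa [f] using (congrFun hx (Sum.inr j)).symm

theorem definable_image_of_inducedLanguage (hP : (Set.univ : Set M).Definable₁ L P) {A : Set P}
    (hA : (Set.univ : Set P).Definable₁ (inducedLanguage L P) A) :
    (Set.univ : Set M).Definable₁ L (Subtype.val '' A) := by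
  obtain ⟨B, -, hB⟩ := Set.definable_iff_finitely_definable.1 hA
  obtain ⟨φ, hφ⟩ := Set.definable_iff_exists_formula_sum.1 hB
  obtain ⟨D, ⟨χ, rfl⟩, hD⟩ := exists_definable_of_inducedLanguage hP φ
  -- The parameters are substituted as constants; the single free variable is kept.
  let tf : ((B : Set P) ⊕ Fin 1) ⊕ Fin 0 → (L[[(Set.univ : Set M)]]).Term (Fin 1) :=
    Sum.elim (Sum.elim (fun b => (L.con (⟨b.1.1, trivial⟩ : (Set.univ : Set M))).term)
      fun i => Language.Term.var i) fun i => i.elim0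
  have h1 : (Set.univ : Set M).Definable L {x : Fin 1 → M | (χ.subst tf).Realize x default} :=
    ⟨χ.subst tf, rfl⟩
  suffices h2 : {x : Fin 1 → M | x 0 ∈ Subtype.val '' A} =
      {x | x 0 ∈ P} ∩ {x : Fin 1 → M | (χ.subst tf).Realize x default} by
    rw [Set.Definable₁, h2]
    exact Set.Definable.inter hP h1
  ext x
  symm
  have hmem : ∀ a : P, a ∈ A ↔ φ.Realize (Sum.elim (fun b => (b : P)) fun _ => a) :=
    fun a => Set.ext_iff.1 hφ fun _ => a
  have key : ∀ a : P, x 0 = a → (a ∈ A ↔ (χ.subst tf).Realize x default) := fun a ha => by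
    rw [hmem, Language.Formula.Realize, hD, Language.BoundedFormula.realize_subst]
    change χ.Realize _ ↔ χ.Realize _
    apply iff_of_eq
    congr 1
    funext i
    rcases i with (b | i) | i
    · simp [tf]
    · rw [Fin.eq_zero i]
      simp [tf, ha]
    · exact i.elim0
  constructor
  · rintro ⟨h2, h3⟩
    exact ⟨⟨x 0, h2⟩, (key _ rfl).2 h3, rfl⟩
  · rintro ⟨a, ha, h2⟩
    exact ⟨show x 0 ∈ P from h2 ▸ a.2, (key a h2.symm).1 ha⟩

end InducedDefinability

/-! ### O-minimality of `Ψ` -/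

section OMinimal

variable {Γ : Type*} [AddCommGroup Γ] [LinearOrder Γ] [IsOrderedAddMonoid Γ] [AsymptoticCouple Γ]

/-- Since `p` is `∞` off `Ψ` above `s0`, the equation `s(p x) = x` detects the elements of `Ψ` other
than `s0`. The point `∞` also satisfies it and is excluded separately. -/
theorem mem_PsiTop_iff (hM : IsModelTlog Γ) (x : WithTop Γ) :
    x ∈ PsiTop Γ ↔ x ≠ ⊤ ∧
      (x = (succ 0 : Γ) ∨ (pred x).map (fun γ : Γ => succ γ) = x) := by
  constructor
  · rintro ⟨u, hu, rfl⟩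
    refine ⟨WithTop.coe_ne_top, ?_⟩
    by_cases h : u = succ 0
    · exact Or.inl (by rw [h])
    · obtain ⟨v, hv, rfl⟩ := hM.exists_pred hu h
      exact Or.inr (by rw [pred_coe_succ hM hv]; rfl)
  · rintro ⟨h0, rfl | h⟩
    · exact ⟨_, hM.succ_mem 0, rfl⟩
    · induction x using WithTop.recTopCoe with
      | top => exact absurd rfl h0
      | coe u =>
        by_cases hu : u ∈ Psi Γ ∧ succ 0 < u
        · exact ⟨u, hu.1, rfl⟩
        · simp only [pred, if_neg hu] at h
          exact absurd h.symm h0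

theorem definable_PsiTop (hM : IsModelTlog Γ) :
    (Set.univ : Set (WithTop Γ)).Definable₁ Llog (PsiTop Γ) := by
  refine Set.Definable.mono (A := ∅) (Set.empty_definable_iff.2 ?_) (Set.empty_subset _)
  let x : Llog.Term (Fin 1) := Language.Term.var 0
  let s0 : Llog.Term (Fin 1) := Language.Term.func (LlogFunc.succ : Llog.Functions 1)
    ![Language.Term.func (LlogFunc.zero : Llog.Functions 0) ![] ]
  let sp : Llog.Term (Fin 1) := Language.Term.func (LlogFunc.succ : Llog.Functions 1)
    ![Language.Term.func (LlogFunc.pred : Llog.Functions 1) ![x] ]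
  let t : Llog.Term (Fin 1) := Language.Term.func (LlogFunc.infty : Llog.Functions 0) ![]
  refine ⟨(x.equal t).not ⊓ (x.equal s0 ⊔ sp.equal x), ?_⟩
  ext v
  refine (mem_PsiTop_iff hM (v 0)).trans ?_
  simp only [Set.mem_ofPred_eq, Language.Formula.realize_inf, Language.Formula.realize_not,
    Language.Formula.realize_sup, Language.Formula.realize_equal]
  exact Iff.rfl

theorem isOMinimal_induced (hM : IsModelTlog Γ) :
    IsOMinimal (inducedLanguage Llog (PsiTop Γ)) (PsiTop Γ) := by
  classical
  constructor
  · rw [Set.empty_definable_iff]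
    let R : (inducedLanguage Llog (PsiTop Γ)).Relations 2 :=
      ⟨{x | x 0 < x 1}, {x | x 0 < x 1}, by
        refine Set.Definable.mono (A := ∅) (Set.empty_definable_iff.2 ?_) (Set.empty_subset _)
        exact ⟨Language.Relations.formula₂ (LlogRel.lt : Llog.Relations 2)
          (Language.Term.var 0) (Language.Term.var 1), rfl⟩, rfl⟩
    exact ⟨R.formula fun i => Language.Term.var i, rfl⟩
  · intro A hA
    obtain ⟨F, hF, hAF, hFI⟩ := exists_finite_intervals hM (A := Subtype.val '' A)
      (by rintro _ ⟨a, -, rfl⟩; exact a.2)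
      (definable_image_of_inducedLanguage (definable_PsiTop hM) hA)
    have hA' : A = ⋃₀ ((fun I => Subtype.val ⁻¹' I) '' F) := by
      rw [Set.sUnion_image, ← Set.preimage_iUnion₂, ← Set.sUnion_eq_biUnion, ← hAF,
        Set.preimage_image_eq _ Subtype.val_injective]
    choose! lo hlo hi hhi hlt hI using hFI
    -- Each interval `[lo, hi)` splits into its left endpoint and an open interval, which is a ray
    -- when `hi = ∞`.
    let pt : Set (WithTop Γ) → Set (PsiTop Γ) := fun I => {x | x.1 = lo I}
    let op : Set (WithTop Γ) → Set (PsiTop Γ) := fun I => {x | lo I < x.1 ∧ x.1 < hi I}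
    refine ⟨pt '' F ∪ op '' F, (hF.image _).union (hF.image _), ?_, ?_⟩
    · rw [hA', Set.sUnion_union, Set.sUnion_image, Set.sUnion_image, Set.sUnion_image]
      ext x
      simp only [Set.mem_iUnion, Set.mem_union, exists_prop]
      rw [← exists_or]
      refine exists_congr fun I => ?_
      rw [← and_or_left]
      refine and_congr_right fun hIF => ?_
      refine (Set.ext_iff.1 (hI I hIF) x.1).trans ?_
      constructor
      · rintro ⟨-, h1, h2⟩
        rcases h1.eq_or_lt with h1 | h1
        · exact Or.inl h1.symm
        · exact Or.inr ⟨h1, h2⟩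
      · rintro (h1 | ⟨h1, h2⟩)
        · exact ⟨x.2, h1.ge, by rw [h1]; exact hlt I hIF⟩
        · exact ⟨x.2, h1.le, h2⟩
    · have hloΨ : ∀ I ∈ F, lo I ∈ PsiTop Γ := fun I hIF =>
        (hlo I hIF).resolve_right fun h => (hlt I hIF).ne_top h
      rintro _ (⟨I, hIF, rfl⟩ | ⟨I, hIF, rfl⟩)
      · exact Or.inl ⟨⟨lo I, hloΨ I hIF⟩, by ext x; simp [pt, Subtype.ext_iff]⟩
      · right
        rcases hhi I hIF with h | h
        · exact Or.inl ⟨⟨lo I, hloΨ I hIF⟩, ⟨hi I, h⟩, rfl⟩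
        · refine Or.inr (Or.inl ⟨⟨lo I, hloΨ I hIF⟩, ?_⟩)
          ext x
          have hx : x.1 < ⊤ := by
            obtain ⟨u, -, hu⟩ := x.2
            rw [← hu]
            exact WithTop.coe_lt_top u
          have hh : hi I = ⊤ := h
          simp only [op, hh, Set.mem_ofPred_eq, hx, and_true, Set.mem_Ioi]
          rfl

end OMinimal
end AsymptoticCouples
end

theorem mainTheorem7 (Γ : Type*) [AddCommGroup Γ] [LinearOrder Γ] [IsOrderedAddMonoid Γ]
    [AsymptoticCouples.AsymptoticCouple Γ] (hΓ : AsymptoticCouples.IsModelTlog Γ) :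
    (∀ A : Set (WithTop Γ), A ⊆ AsymptoticCouples.PsiTop Γ →
      (Set.univ : Set (WithTop Γ)).Definable₁ AsymptoticCouples.Llog A →
      ∃ F : Set (Set (WithTop Γ)), F.Finite ∧ A = ⋃₀ F ∧ ∀ I ∈ F,
        AsymptoticCouples.IsPsiInterval Γ I ∨ ∃ x ∈ AsymptoticCouples.PsiTop Γ, I = {x}) ∧
    AsymptoticCouples.IsOMinimal
      (AsymptoticCouples.inducedLanguage AsymptoticCouples.Llog (AsymptoticCouples.PsiTop Γ))
      (AsymptoticCouples.PsiTop Γ) := by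
  refine ⟨fun A hAΨ hA => ?_, AsymptoticCouples.isOMinimal_induced hΓ⟩
  obtain ⟨F, hF, hAF, hI⟩ := AsymptoticCouples.exists_finite_intervals hΓ hAΨ hA
  -- Separate points are not needed, because `{α} = [α, sα)` in `Ψ`.
  exact ⟨F, hF, hAF, fun I h => Or.inl (hI I h)⟩
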